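/- **Setting.** Let $\Omega\subset\mathbb R^2$ be a bounded domain, $(\cdot,\cdot)$ and $\|\cdot\|$ the inner product and norm of $\mathbf L^2=[L^2(\Omega)]^2$ (or of $L^2(\Omega)$), $\mathbf H^1_0=[H^1_0(\Omega)]^2$, $\mathbf J_1=\{v\in\mathbf H_0^1:\nabla\cdot v=0\}$, and let $\|\cdot\|_1,\|\cdot\|_2$ be the $H^1$- and $H^2$-norms. Assume that $\Omega$ is regular for the Stokes problem: there is $C$ such that for every $g\in\mathbf L^2$ the weak solution $v\in\mathbf J_1$, $q\in L^2/\mathbb R$ of $-\Delta v+\nabla q=g$, $\nabla\cdot v=0$ satisfies $\|v\|_2+\|q\|_{H^1/\mathbb R}\le C\|g\|$. Let $\mu,\gamma,\delta,M_0,K_0,K_5>0$, $\beta(t)=\gamma e^{-\delta t}$, let $\lambda_1$ be the smallest eigenvalue of the Stokes operator, and $0<\alpha<\min\{\mu\lambda_1,\delta\}$. Put $$a(v,w)=(\nabla v,\nabla w),\qquad b(v,w,\phi)=\tfrac12(v\cdot\nabla w,\phi)-\tfrac12(v\cdot\nabla\phi,w).$$ Let $0<t_0<T\le\infty$; let $u_0\in\mathbf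 J_1$ with $\|\nabla u_0\|\le M_0$ and $f,f_t\in L^\infty(0,T;\mathbf L^2)$ with $\sup\|f\|,\sup\|f_t\|\le M_0$ ($f$ is taken continuous in time). Let $0<h<H<1$. For $k\in\{h,H\}$ let $\mathbf H_k\subset\mathbf H^1_0$ and $L_k\subset L^2(\Omega)$ be finite dimensional, $\mathbf J_k=\{v\in\mathbf H_k:(\chi,\nabla\cdot v)=0\ \ \forall\chi\in L_k\}$, and $P_k$ the $\mathbf L^2$-orthogonal projection onto $\mathbf J_k$. Assume: * for each $w\in\mathbf H_0^1\cap\mathbf H^2$ there is $i_kw\in\mathbf H_k$ with $\|w-i_kw\|+k\|\nabla(w-i_kw)\|\le K_0k^2\|w\|_2$; * for each $q\in H^1/\mathbb R$ there is $j_kq\in L_k$ with $\|q-j_kq\|_{L^2/\mathbb R}\le K_0k\|q\|_{H^1/\mathbb R}$; * $\|\nabla w\|\le K_0k^{-1}\|w\|$ for $w\in\mathbf H_k$; * for each $w\in\mathbf J_1\cap\mathbf H^2$ there is $r_kw\in\mathbf J_k$ with $\|w-r_kw\|+k\|\nabla(w-r_kw)\|\le K_5k^2\|w\|_2$. Put $\mathbf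 J_h^H=(I-P_H)\mathbf J_h$ and assume $\mathbf J_h=\mathbf J_H+\mathbf J_h^H$. Let $u_h:[0,t_0]\to\mathbf J_h$ be the Galerkin approximation: it is continuous, $u_h(0)=P_hu_0$, and for $0<t\le t_0$ and all $\phi\in\mathbf J_h$, $$(u_{h,t},\phi)+\mu a(u_h,\phi)+\int_0^t\beta(t-s)a(u_h(s),\phi)\,ds=-b(u_h,u_h,\phi)+(f,\phi).$$ Let $(y^H,z^h)$, with $y^H(t)\in\mathbf J_H$, $z^h(t)\in\mathbf J_h^H$ and $u^h=y^H+z^h$, be a solution of one of the two nonlinear Galerkin methods (NLG), that is, $y^H(t_0)=P_Hu_h(t_0)$, $y^H$ is continuous and is differentiable for $t>t_0$, $u^h$ is locally square integrable in time on $[t_0,T]$ (on $[t_0,\infty)$ if $T=\infty$), and for all $t>t_0$ ($t\le T$, $t<\infty$), all $\phi\in\mathbf J_H$ and all $\chi\in\mathbf J_h^H$, $$(y^H_t,\phi)+\mu a(u^h,\phi)+b(u^h,u^h,\phi)+\int_{t_0}^t\beta(t-s)a(u^h(s),\phi)\,ds=(f,\phi),$$ $$\mu a(u^h,\chi)+N(\chi)+\int_{t_0}^t\beta(t-s)a(u^h(s),\chi)\,ds=(f,\chi),$$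 where $N(\chi)=b(u^h,u^h,\chi)$ (NLG I) or $N(\chi)=b(u^h,y^H,\chi)+b(y^H,z^h,\chi)$ (NLG II). **Lemma 4.1.** There is a constant $K>0$ depending only on $\Omega,\mu,\gamma,\delta,\alpha,M_0,K_0,K_5$ (in particular not on $h,H,t,t_0,T$, the spaces, $u_0$, $f$ or the solutions) such that the following holds. 1. For all $t>t_0$ ($t\le T$, $t<\infty$), $s\mapsto e^{2\alpha s}\|\nabla u^h(s)\|^2$ is integrable on $(t_0,t)$ and $$\|y^H(t)\|^2+e^{-2\alpha t}\int_{t_0}^te^{2\alpha s}\|\nabla u^h(s)\|^2\,ds\le K.$$ 2. Let $H_0\in(0,1)$ and $\kappa_1,\kappa_2>0$. There is $c>0$, depending only on these numbers and on the data listed above, such that whenever $H\le H_0$ and $\kappa_1|\log H|^{1/2}\le L_H\le\kappa_2|\log h|^{1/2}$ (in particular whenever $\kappa_1|\log h|^{1/2}\le L_H\le\kappa_2|\log h|^{1/2}$, i.e. $L_H\sim|\log h|^{1/2}$), every $t>t_0$ ($t\le T$, $t<\infty$) with $$\mu-cL_H^2\|y^H(t)\|^2>0$$ satisfies $\|z^h(t)\|\le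 K$. -/

import Mathlib

open MeasureTheory Set Filter Topology
open scoped ContDiff

noncomputable section

namespace Oldroyd

/-- The plane `ℝ²` with its Euclidean norm. -/
abbrev Plane : Type := EuclideanSpace ℝ (Fin 2)

/-- A bounded domain (non-empty, open, connected) of `ℝ²`. -/
structure PlanarDomain where
  carrier : Set Plane
  isOpen : IsOpen carrier
  isConnected : IsConnected carrier
  isBounded : Bornology.IsBounded carrier

/-- Lebesgue measure on `Ω`. -/
abbrev vol (Ω : PlanarDomain) : Measure Plane := volume.restrict Ω.carrier

/-- `L²(Ω)`. -/
abbrev L2 (Ω : PlanarDomain) : Type := Lp ℝ 2 (vol Ω)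

/-- `𝐋² = [L²(Ω)]²`, with `(v, w) = ∑ i, (vᵢ, wᵢ)`. -/
abbrev VL2 (Ω : PlanarDomain) : Type := PiLp 2 (fun _ : Fin 2 => L2 Ω)

/-! ### Weak derivatives and Sobolev spaces -/

/-- Test functions `C_c^∞(Ω)`. -/
def IsTest (Ω : PlanarDomain) (φ : Plane → ℝ) : Prop :=
  ContDiff ℝ ∞ φ ∧ HasCompactSupport φ ∧ tsupport φ ⊆ Ω.carrier

/-- The classical partial derivative `∂ⱼ φ`. -/
def classicalPd (j : Fin 2) (φ : Plane → ℝ) (x : Plane) : ℝ :=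
  fderiv ℝ φ x (EuclideanSpace.single j 1)

/-- `g ∈ L²(Ω)` is the weak derivative `∂ⱼ u` of `u ∈ L²(Ω)`. -/
def HasWeakPd {Ω : PlanarDomain} (j : Fin 2) (u g : L2 Ω) : Prop :=
  ∀ φ : Plane → ℝ, IsTest Ω φ →
    ∫ x, u x * classicalPd j φ x ∂(vol Ω) = - ∫ x, g x * φ x ∂(vol Ω)

/-- `u ∈ H¹(Ω)`. -/
def MemH1 {Ω : PlanarDomain} (u : L2 Ω) : Prop := ∀ j : Fin 2, ∃ g : L2 Ω, HasWeakPd j u g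

open Classical in
/-- The weak derivative `∂ⱼ u` of `u ∈ H¹(Ω)` (only used for such `u`; unique by
`HasWeakPd.unique` below). -/
def pd {Ω : PlanarDomain} (j : Fin 2) (u : L2 Ω) : L2 Ω :=
  if h : ∃ g : L2 Ω, HasWeakPd j u g then h.choose else 0

theorem integrable_mul_test {Ω : PlanarDomain} (u : L2 Ω) {ψ : Plane → ℝ}
    (hc : Continuous ψ) (hs : HasCompactSupport ψ) :
    Integrable (fun x => u x * ψ x) (vol Ω) :=
  MemLp.integrable_mul (p := 2) (q := 2) (Lp.memLp u) (hc.memLp_of_hasCompactSupport hs)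

theorem integrable_mul_classicalPd {Ω : PlanarDomain} (u : L2 Ω) (j : Fin 2) {φ : Plane → ℝ}
    (hφ : IsTest Ω φ) : Integrable (fun x => u x * classicalPd j φ x) (vol Ω) := by
  refine integrable_mul_test u ?_ ?_
  · exact (hφ.1.continuous_fderiv (by simp)).clm_apply continuous_const
  · exact hφ.2.1.fderiv_apply (𝕜 := ℝ) (EuclideanSpace.single j 1)

theorem HasWeakPd.unique {Ω : PlanarDomain} {j : Fin 2} {u g g' : L2 Ω}
    (h : HasWeakPd j u g) (h' : HasWeakPd j u g') : g = g' := by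
  have key : ∀ᵐ x ∂(vol Ω), x ∈ Ω.carrier → (g - g' : L2 Ω) x = 0 := by
    refine Ω.isOpen.ae_eq_zero_of_integral_contDiff_smul_eq_zero ?_ ?_
    · exact ((Lp.memLp (g - g')).locallyIntegrable (by norm_num)).locallyIntegrableOn _
    · intro φ h1 h2 h3
      have e := h φ ⟨h1, h2, h3⟩
      have e' := h' φ ⟨h1, h2, h3⟩
      have hi : ∫ x, φ x • (g - g' : L2 Ω) x ∂(vol Ω)
          = ∫ x, (g x * φ x - g' x * φ x) ∂(vol Ω) := by
        refine integral_congr_ae ?_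
        filter_upwards [Lp.coeFn_sub g g'] with x hx
        rw [hx, Pi.sub_apply, smul_eq_mul]
        ring
      rw [hi, integral_sub (integrable_mul_test g h1.continuous h2)
        (integrable_mul_test g' h1.continuous h2)]
      linarith
  have hmem : ∀ᵐ x ∂(vol Ω), x ∈ Ω.carrier := ae_restrict_mem Ω.isOpen.measurableSet
  rw [← sub_eq_zero]
  refine Lp.ext ?_
  filter_upwards [key, hmem, Lp.coeFn_zero ℝ 2 (vol Ω)] with x hx hx' h0
  rw [hx hx', h0, Pi.zero_apply]

theorem MemH1.hasWeakPd {Ω : PlanarDomain} {u : L2 Ω} (hu : MemH1 u) (j : Fin 2) :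
    HasWeakPd j u (pd j u) := by
  unfold pd
  rw [dif_pos (hu j)]
  exact (hu j).choose_spec

theorem HasWeakPd.pd_eq {Ω : PlanarDomain} {j : Fin 2} {u g : L2 Ω} (h : HasWeakPd j u g) :
    pd j u = g := by
  have hex : ∃ g : L2 Ω, HasWeakPd j u g := ⟨g, h⟩
  unfold pd
  rw [dif_pos hex]
  exact hex.choose_spec.unique h

theorem HasWeakPd.zero {Ω : PlanarDomain} (j : Fin 2) : HasWeakPd j (0 : L2 Ω) 0 := by
  intro φ _
  have e : ∀ ψ : Plane → ℝ, ∫ x, (0 : L2 Ω) x * ψ x ∂(vol Ω) = 0 := by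
    intro ψ
    refine integral_eq_zero_of_ae ?_
    filter_upwards [Lp.coeFn_zero ℝ 2 (vol Ω)] with x hx
    rw [hx]
    simp
  rw [e, e, neg_zero]

theorem HasWeakPd.add {Ω : PlanarDomain} {j : Fin 2} {u g u' g' : L2 Ω}
    (h : HasWeakPd j u g) (h' : HasWeakPd j u' g') : HasWeakPd j (u + u') (g + g') := by
  intro φ hφ
  have e1 : ∫ x, (u + u' : L2 Ω) x * classicalPd j φ x ∂(vol Ω)
      = ∫ x, (u x * classicalPd j φ x + u' x * classicalPd j φ x) ∂(vol Ω) := by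
    refine integral_congr_ae ?_
    filter_upwards [Lp.coeFn_add u u'] with x hx
    rw [hx, Pi.add_apply, add_mul]
  have e2 : ∫ x, (g + g' : L2 Ω) x * φ x ∂(vol Ω)
      = ∫ x, (g x * φ x + g' x * φ x) ∂(vol Ω) := by
    refine integral_congr_ae ?_
    filter_upwards [Lp.coeFn_add g g'] with x hx
    rw [hx, Pi.add_apply, add_mul]
  rw [e1, e2, integral_add (integrable_mul_classicalPd u j hφ) (integrable_mul_classicalPd u' j hφ),
    integral_add (integrable_mul_test g hφ.1.continuous hφ.2.1)
      (integrable_mul_test g' hφ.1.continuous hφ.2.1), h φ hφ, h' φ hφ]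
  ring

theorem HasWeakPd.smul {Ω : PlanarDomain} {j : Fin 2} {u g : L2 Ω} (c : ℝ)
    (h : HasWeakPd j u g) : HasWeakPd j (c • u) (c • g) := by
  intro φ hφ
  have e : ∀ (v : L2 Ω) (ψ : Plane → ℝ), ∫ x, (c • v : L2 Ω) x * ψ x ∂(vol Ω)
      = c * ∫ x, v x * ψ x ∂(vol Ω) := by
    intro v ψ
    rw [← integral_const_mul]
    refine integral_congr_ae ?_
    filter_upwards [Lp.coeFn_smul c v] with x hx
    rw [hx, Pi.smul_apply, smul_eq_mul, mul_assoc]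
  rw [e, e, h φ hφ]
  ring

/-- `u ∈ H²(Ω)`. -/
def MemH2 {Ω : PlanarDomain} (u : L2 Ω) : Prop := MemH1 u ∧ ∀ j, MemH1 (pd j u)

/-- `u ∈ H¹₀(Ω)`: the closure of `C_c^∞(Ω)` in `H¹(Ω)`. -/
def MemH10 {Ω : PlanarDomain} (u : L2 Ω) : Prop :=
  MemH1 u ∧ ∃ φ : ℕ → Plane → ℝ, (∀ n, IsTest Ω (φ n)) ∧
    Tendsto (fun n => eLpNorm (fun x => u x - φ n x) 2 (vol Ω)) atTop (𝓝 0) ∧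
    ∀ j, Tendsto (fun n => eLpNorm (fun x => pd j u x - classicalPd j (φ n) x) 2 (vol Ω))
      atTop (𝓝 0)

/-- The norm of `H¹(Ω)`. -/
def normH1 {Ω : PlanarDomain} (q : L2 Ω) : ℝ := √(‖q‖ ^ 2 + ∑ j, ‖pd j q‖ ^ 2)

/-- `v ∈ 𝐇¹₀ = [H¹₀(Ω)]²`. -/
def VMemH10 {Ω : PlanarDomain} (v : VL2 Ω) : Prop := ∀ i, MemH10 (v i)

/-- `v ∈ 𝐇² = [H²(Ω)]²`. -/
def VMemH2 {Ω : PlanarDomain} (v : VL2 Ω) : Prop := ∀ i, MemH2 (v i)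

/-- The norm `‖v‖₂` of `𝐇²`. -/
def normH2 {Ω : PlanarDomain} (v : VL2 Ω) : ℝ :=
  √(∑ i, (‖v i‖ ^ 2 + ∑ j, ‖pd j (v i)‖ ^ 2 + ∑ j, ∑ k, ‖pd k (pd j (v i))‖ ^ 2))

/-- `∇ · v`. -/
def divergence {Ω : PlanarDomain} (v : VL2 Ω) : L2 Ω := ∑ i, pd i (v i)

/-- `a(v, w) = (∇v, ∇w) = ∑ᵢⱼ (∂ⱼ vᵢ, ∂ⱼ wᵢ)`. -/
def a {Ω : PlanarDomain} (v w : VL2 Ω) : ℝ := ∑ i, ∑ j, inner ℝ (pd j (v i)) (pd j (w i))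

/-- `‖∇v‖ = (∑ᵢⱼ ‖∂ⱼ vᵢ‖²)^{1/2}`. -/
def gradNorm {Ω : PlanarDomain} (v : VL2 Ω) : ℝ := √(∑ i, ∑ j, ‖pd j (v i)‖ ^ 2)

/-- `(v · ∇w, φ) = ∑ᵢⱼ ∫_Ω vⱼ (∂ⱼ wᵢ) φᵢ dx`. -/
def conv {Ω : PlanarDomain} (v w φ : VL2 Ω) : ℝ :=
  ∑ i, ∑ j, ∫ x, v j x * pd j (w i) x * φ i x ∂(vol Ω)

/-- The antisymmetrized trilinear form `b`. -/
def b {Ω : PlanarDomain} (v w φ : VL2 Ω) : ℝ := conv v w φ / 2 - conv v φ w / 2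

/-- `v ∈ 𝐉₁ = {v ∈ 𝐇¹₀ : ∇ · v = 0}`. -/
def MemJ1 {Ω : PlanarDomain} (v : VL2 Ω) : Prop := VMemH10 v ∧ divergence v = 0

/-- `ev` is an eigenvalue of the Stokes operator (in its weak form). -/
def IsStokesEigenvalue (Ω : PlanarDomain) (ev : ℝ) : Prop :=
  ∃ v : VL2 Ω, MemJ1 v ∧ v ≠ 0 ∧ ∀ w : VL2 Ω, MemJ1 w → a v w = ev * inner ℝ v w

/-- Regularity of the steady Stokes problem `-Δv + ∇q = g`, `∇ · v = 0`, `v = 0` on `∂Ω` on the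
domain `Ω`: for each `g ∈ 𝐋²` the weak solution satisfies `‖v‖₂ + ‖q‖_{H¹/ℝ} ≤ C ‖g‖`.
The velocity is determined by the equations and `q` up to a constant; the `q` below is a
representative of its class in `H¹/ℝ`. -/
def StokesRegular (Ω : PlanarDomain) : Prop :=
  ∃ C : ℝ, ∀ g : VL2 Ω, ∃ (v : VL2 Ω) (q : L2 Ω),
    MemJ1 v ∧ (∀ w : VL2 Ω, VMemH10 w → a v w - inner ℝ q (divergence w) = inner ℝ g w) ∧
    VMemH2 v ∧ MemH1 q ∧ normH2 v + normH1 q ≤ C * ‖g‖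

/-! ### Finite element spaces -/

/-- A pair of finite dimensional spaces `(𝐇_h, L_h)`, `𝐇_h ⊆ 𝐇¹₀`, `L_h ⊆ L²`. -/
structure FEPair (Ω : PlanarDomain) where
  velocity : Submodule ℝ (VL2 Ω)
  pressure : Submodule ℝ (L2 Ω)
  finiteVelocity : FiniteDimensional ℝ velocity
  finitePressure : FiniteDimensional ℝ pressure
  velocity_mem : ∀ v ∈ velocity, VMemH10 v

namespace FEPair

variable {Ω : PlanarDomain}

/-- `𝐉_h = {v ∈ 𝐇_h : (χ, ∇ · v) = 0 for all χ ∈ L_h}`. -/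
def J (S : FEPair Ω) : Submodule ℝ (VL2 Ω) where
  carrier := {v | v ∈ S.velocity ∧ ∀ χ ∈ S.pressure, inner ℝ χ (divergence v) = 0}
  zero_mem' := by
    refine ⟨S.velocity.zero_mem, fun χ _ => ?_⟩
    have e : divergence (0 : VL2 Ω) = 0 := by
      unfold divergence
      refine Finset.sum_eq_zero fun i _ => ?_
      exact (HasWeakPd.zero i).pd_eq
    rw [e, inner_zero_right]
  add_mem' := by
    rintro v w ⟨hv, hv'⟩ ⟨hw, hw'⟩
    refine ⟨S.velocity.add_mem hv hw, fun χ hχ => ?_⟩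
    have e : divergence (v + w) = divergence v + divergence w := by
      unfold divergence
      rw [← Finset.sum_add_distrib]
      refine Finset.sum_congr rfl fun i _ => ?_
      exact (((S.velocity_mem v hv i).1.hasWeakPd i).add
        ((S.velocity_mem w hw i).1.hasWeakPd i)).pd_eq
    rw [e, inner_add_right, hv' χ hχ, hw' χ hχ, add_zero]
  smul_mem' := by
    rintro c v ⟨hv, hv'⟩
    refine ⟨S.velocity.smul_mem c hv, fun χ hχ => ?_⟩
    have e : divergence (c • v) = c • divergence v := by
      unfold divergence
      rw [Finset.smul_sum]
      refine Finset.sum_congr rfl fun i _ => ?_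
      exact (((S.velocity_mem v hv i).1.hasWeakPd i).smul c).pd_eq
    rw [e, inner_smul_right, hv' χ hχ, mul_zero]

instance finiteDimensional_J (S : FEPair Ω) : FiniteDimensional ℝ S.J := by
  have := S.finiteVelocity
  exact Submodule.finiteDimensional_of_le (fun _ hv => hv.1 : S.J ≤ S.velocity)

/-- The `L²` projection `P_h : 𝐋² → 𝐉_h`. -/
def P (S : FEPair Ω) : VL2 Ω →L[ℝ] VL2 Ω := S.J.starProjection

/-- Approximation and inverse properties, with mesh parameter `h` and constants `K₀`, `K₅`:
for every `w ∈ 𝐇¹₀ ∩ 𝐇²` there is `i_h w ∈ 𝐇_h` with `‖w - i_h w‖ + h ‖∇(w - i_h w)‖ ≤ K₀ h² ‖w‖₂`;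
for every `q ∈ H¹/ℝ` there is `j_h q ∈ L_h` with `‖q - j_h q‖ ≤ K₀ h ‖q‖₁` (norms modulo constants);
`‖∇w‖ ≤ K₀ h⁻¹ ‖w‖` on `𝐇_h`; for every `w ∈ 𝐉₁ ∩ 𝐇²` there is `r_h w ∈ 𝐉_h` with
`‖w - r_h w‖ + h ‖∇(w - r_h w)‖ ≤ K₅ h² ‖w‖₂`. -/
structure Approximates (S : FEPair Ω) (h K₀ K₅ : ℝ) : Prop where
  velocity_approx : ∀ w : VL2 Ω, VMemH10 w → VMemH2 w →
    ∃ wh ∈ S.velocity, ‖w - wh‖ + h * gradNorm (w - wh) ≤ K₀ * h ^ 2 * normH2 w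
  pressure_approx : ∀ q : L2 Ω, MemH1 q →
    ∃ qh ∈ S.pressure, ∃ r : ℝ,
      eLpNorm (fun x => q x - qh x - r) 2 (vol Ω) ≤ ENNReal.ofReal (K₀ * h * normH1 q)
  inverse : ∀ w ∈ S.velocity, gradNorm w ≤ K₀ * h⁻¹ * ‖w‖
  divfree_approx : ∀ w : VL2 Ω, MemJ1 w → VMemH2 w →
    ∃ wh ∈ S.J, ‖w - wh‖ + h * gradNorm (w - wh) ≤ K₅ * h ^ 2 * normH2 w

/-- `𝐉_h^H = (I - P_H) 𝐉_h`, for the fine pair `S` and the coarse pair `SH`. -/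
def fineComplement (S SH : FEPair Ω) : Submodule ℝ (VL2 Ω) :=
  S.J.map ((ContinuousLinearMap.id ℝ (VL2 Ω) - SH.P : VL2 Ω →L[ℝ] VL2 Ω) : VL2 Ω →ₗ[ℝ] VL2 Ω)

end FEPair

/-! ### The schemes -/

/-- The memory kernel `β(t) = γ exp(-δ t)`. -/
def kernel (γ δ t : ℝ) : ℝ := γ * Real.exp (-δ * t)

/-- The time interval `[t₀, T]`, which is `[t₀, ∞)` for `T = ∞`. -/
def timeSet (t₀ : ℝ) (T : EReal) : Set ℝ := {t | t₀ ≤ t ∧ (t : EReal) ≤ T}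

/-- `f, f_t ∈ L^∞(0, T; 𝐋²)` with `sup ‖f‖, sup ‖f_t‖ ≤ M₀`; `f` is the representative that is
continuous in time and `f'` is the (weak) time derivative `f_t`. -/
def BoundedForce {Ω : PlanarDomain} (f : ℝ → VL2 Ω) (M₀ : ℝ) (T : EReal) : Prop :=
  (∀ t ∈ timeSet 0 T, 0 < t → ‖f t‖ ≤ M₀) ∧
  ∃ f' : ℝ → VL2 Ω, AEStronglyMeasurable f' (volume.restrict (timeSet 0 T)) ∧
    (∀ᵐ t ∂(volume.restrict (timeSet 0 T)), ‖f' t‖ ≤ M₀) ∧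
    ∀ s ∈ timeSet 0 T, ∀ t ∈ timeSet 0 T, 0 < s → s ≤ t → f t - f s = ∫ r in s..t, f' r

/-- The classical (semi-discrete) Galerkin approximation `u_h` on `[0, t₀]`:
`u_h(0) = P_h u₀` and, for `0 < t ≤ t₀` and `φ ∈ 𝐉_h`,
`(u_{h,t}, φ) + μ a(u_h, φ) + ∫₀ᵗ β(t-s) a(u_h(s), φ) ds = -b(u_h, u_h, φ) + (f, φ)`. -/
structure IsGalerkin {Ω : PlanarDomain} (S : FEPair Ω) (μ γ δ : ℝ) (f : ℝ → VL2 Ω) (u₀ : VL2 Ω)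
    (t₀ : ℝ) (uh : ℝ → VL2 Ω) : Prop where
  mem : ∀ t ∈ Icc 0 t₀, uh t ∈ S.J
  continuousOn : ContinuousOn uh (Icc 0 t₀)
  init : uh 0 = S.P u₀
  equation : ∀ t ∈ Ioc 0 t₀, ∃ ut : VL2 Ω, HasDerivWithinAt uh ut (Icc 0 t₀) t ∧
    ∀ φ ∈ S.J, inner ℝ ut φ + μ * a (uh t) φ + ∫ s in (0 : ℝ)..t, kernel γ δ (t - s) * a (uh s) φ
      = - b (uh t) (uh t) φ + inner ℝ (f t) φ

/-- The nonlinear term of the fine-grid equation of the first method, `b(u^h, u^h, χ)`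
with `u^h = y + z`. -/
def fineTermI {Ω : PlanarDomain} (y z χ : VL2 Ω) : ℝ := b (y + z) (y + z) χ

/-- The nonlinear term of the fine-grid equation of the second method,
`b(u^h, y, χ) + b(y, z, χ)` with `u^h = y + z`. -/
def fineTermII {Ω : PlanarDomain} (y z χ : VL2 Ω) : ℝ := b (y + z) y χ + b y z χ

/-- `(y, z) = (y^H, z^h)` solves the nonlinear Galerkin system on `(t₀, T]` (on `(t₀, ∞)` if
`T = ∞`) with `u^h = y + z`, started from `y(t₀) = P_H u_h(t₀)`; `N` is the nonlinear term of the
fine-grid equation. The function `y` is continuous and has a time derivative for `t > t₀`, and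
`u^h` is locally square integrable in time (so that the memory term is defined). -/
structure IsNLG {Ω : PlanarDomain} (N : VL2 Ω → VL2 Ω → VL2 Ω → ℝ) (S SH : FEPair Ω)
    (μ γ δ : ℝ) (f : ℝ → VL2 Ω) (t₀ : ℝ) (T : EReal) (uh y z : ℝ → VL2 Ω) : Prop where
  mem_coarse : ∀ t ∈ timeSet t₀ T, y t ∈ SH.J
  mem_fine : ∀ t ∈ timeSet t₀ T, t₀ < t → z t ∈ S.fineComplement SH
  continuousOn : ContinuousOn y (timeSet t₀ T)
  square_integrable : ∀ t ∈ timeSet t₀ T,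
    MemLp (fun s => y s + z s) 2 (volume.restrict (Ioc t₀ t))
  init : y t₀ = SH.P (uh t₀)
  coarse_equation : ∀ t ∈ timeSet t₀ T, t₀ < t →
    ∃ yt : VL2 Ω, HasDerivWithinAt y yt (timeSet t₀ T) t ∧
      ∀ φ ∈ SH.J, inner ℝ yt φ + μ * a (y t + z t) φ + b (y t + z t) (y t + z t) φ
        + ∫ s in t₀..t, kernel γ δ (t - s) * a (y s + z s) φ = inner ℝ (f t) φ
  fine_equation : ∀ t ∈ timeSet t₀ T, t₀ < t → ∀ χ ∈ S.fineComplement SH,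
    μ * a (y t + z t) χ + N (y t) (z t) χ
      + ∫ s in t₀..t, kernel γ δ (t - s) * a (y s + z s) χ = inner ℝ (f t) χ

end Oldroyd

end

open Oldroyd

/-! Test the coarse equation with `y` and the fine one with `z` and add. The viscous and memory
terms recombine into those of `u = y + z`, and the trilinear terms cancel by antisymmetry of `b`.
Both schemes give the same cancellation, since either fine nonlinearity tested with `z` equals `b u
y z`. The memory term has nonnegative weighted time integral: after factoring the exponentials it is
the derivative of a squared norm times a decreasing weight
(`intervalIntegral_exp_mul_inner_primitive_nonneg`). What remains is an energy inequality
(`weighted_energy_inequality`), used twice: with a small exponential weight it bounds `‖y‖`, the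
term in `‖y‖²` being absorbed by the dissipation through Poincaré; then, `‖y‖` being bounded, the
prescribed weight gives the dissipation bound. The same argument for `u_h` on `[0, t₀]` controls the
initial value.

For `z`, an Aubin–Nitsche argument for the Stokes problem gives `‖z‖ ≤ C H ‖∇z‖`, because `z` is
`L²`-orthogonal to the coarse space (`exists_norm_le_mul_gradNorm_of_orthogonal`). So it suffices to
bound `H ‖∇z‖`. Test the fine equation with `z` alone: the inverse inequality for `y`,
Ladyzhenskaya's inequality and the gain of `H` for `z` make the powers of `H` balance, and the part
quadratic in `‖∇z‖` carries a factor `‖y‖` times a constant (`mul_le_of_absorption`). The condition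
on `L_H` makes that factor at most `μ / 2`, because `L_H²` is bounded below by `κ₁² |log H₀|`. -/

/-! ### Positivity of the memory term and the energy inequality in a Hilbert space -/

/-- The norm of a primitive of an integrable vector valued function is absolutely continuous. -/
theorem absolutelyContinuousOnInterval_norm_integral {E : Type*} [NormedAddCommGroup E]
    [NormedSpace ℝ E] {V : ℝ → E} {a b : ℝ} (hV : IntervalIntegrable V volume a b) :
    AbsolutelyContinuousOnInterval (fun r => ‖∫ s in a..r, V s‖) a b := by
  -- Increments of the norm of the primitive are dominated by those of the primitive of `‖V‖`, so
  -- the same `η` serves both.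
  have hn := hV.norm.absolutelyContinuousOnInterval_intervalIntegral (c := a) (by simp)
  rw [absolutelyContinuousOnInterval_iff] at hn ⊢
  intro ε hε
  obtain ⟨η, hη, h⟩ := hn ε hε
  refine ⟨η, hη, fun I hI hlt => lt_of_le_of_lt (Finset.sum_le_sum fun i hi => ?_) (h I hI hlt)⟩
  have h1 := (hI.1 i hi).1
  have h2 := (hI.1 i hi).2
  have sub : ∀ {x}, x ∈ uIcc a b → IntervalIntegrable V volume a x := fun hx =>
    hV.mono_set (uIcc_subset_uIcc left_mem_uIcc hx)
  refine (dist_norm_norm_le _ _).trans ?_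
  rw [Real.dist_eq, intervalIntegral.integral_interval_sub_left (sub h1) (sub h2),
    intervalIntegral.integral_interval_sub_left (sub h1).norm (sub h2).norm]
  exact intervalIntegral.norm_integral_le_abs_integral_norm

theorem intervalIntegrable_exp_mul_inner_primitive {E : Type*} [NormedAddCommGroup E]
    [InnerProductSpace ℝ E] {V : ℝ → E} {a b c : ℝ} (hV : IntervalIntegrable V volume a b) :
    IntervalIntegrable (fun r => Real.exp (c * r) * inner ℝ (∫ s in a..r, V s) (V r))
      volume a b := by
  have hFc : ContinuousOn (fun r => ∫ s in a..r, V s) (uIcc a b) :=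
    intervalIntegral.continuousOn_primitive_interval' hV left_mem_uIcc
  obtain ⟨C, hC⟩ := isCompact_uIcc.exists_bound_of_continuousOn hFc
  refine IntervalIntegrable.continuousOn_mul ?_ (by fun_prop)
  refine (hV.norm.const_mul C).mono_fun' ?_ ?_
  · exact ((hFc.mono uIoc_subset_uIcc).aestronglyMeasurable measurableSet_uIoc).inner
      hV.aestronglyMeasurable_restrict_uIoc
  · filter_upwards [ae_restrict_mem measurableSet_uIoc] with r hr
    refine (norm_inner_le_norm _ _).trans ?_
    gcongr
    exact hC r (uIoc_subset_uIcc hr)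

/-- With `F` the primitive, `⟨F, V⟩` is half the derivative of `‖F‖²`. Integration by parts leaves
the boundary term at `b` plus `κ` times a nonnegative integral. As `V` is merely integrable, the
product rule holds almost everywhere and absolute continuity supplies the fundamental theorem. -/
theorem intervalIntegral_exp_mul_inner_primitive_nonneg {E : Type*} [NormedAddCommGroup E]
    [InnerProductSpace ℝ E] [CompleteSpace E] {V : ℝ → E} {a b κ : ℝ} (hab : a ≤ b) (hκ : 0 ≤ κ)
    (hV : IntervalIntegrable V volume a b) :
    0 ≤ ∫ r in a..b, Real.exp (-(2 * κ) * r) * inner ℝ (∫ s in a..r, V s) (V r) := by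
  set F : ℝ → E := fun r => ∫ s in a..r, V s with hF
  have hFc : ContinuousOn F (uIcc a b) :=
    intervalIntegral.continuousOn_primitive_interval' hV left_mem_uIcc
  have hexp : AbsolutelyContinuousOnInterval (fun r => Real.exp (-(2 * κ) * r)) a b :=
    ContDiffOn.absolutelyContinuousOnInterval (by fun_prop)
  have hn := absolutelyContinuousOnInterval_norm_integral hV
  have hΦ := hexp.fun_mul (hn.fun_mul hn)
  have key := hΦ.integral_deriv_eq_sub
  have hd : ∀ᵐ r, r ∈ uIoc a b →
      deriv (fun x => Real.exp (-(2 * κ) * x) * (‖F x‖ * ‖F x‖)) r =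
        2 * (Real.exp (-(2 * κ) * r) * inner ℝ (F r) (V r))
          - 2 * κ * (Real.exp (-(2 * κ) * r) * ‖F r‖ ^ 2) := by
    filter_upwards [hV.ae_hasDerivAt_integral] with r hr hrm
    have h1 : HasDerivAt F (V r) r := hr (uIoc_subset_uIcc hrm) a left_mem_uIcc
    have h2 : HasDerivAt (fun x => ‖F x‖ ^ 2) (2 * inner ℝ (F r) (V r)) r := h1.norm_sq
    have h3 : HasDerivAt (fun x => Real.exp (-(2 * κ) * x))
        (Real.exp (-(2 * κ) * r) * (-(2 * κ))) r := by
      simpa using ((hasDerivAt_id r).const_mul (-(2 * κ))).exp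
    have h4 := (h3.mul h2).deriv
    have e : (fun x => Real.exp (-(2 * κ) * x) * (‖F x‖ * ‖F x‖)) =
        (fun x => Real.exp (-(2 * κ) * x)) * fun x => ‖F x‖ ^ 2 := by
      ext x; simp [sq]
    rw [e, h4]; ring
  have i1 := intervalIntegrable_exp_mul_inner_primitive (c := -(2 * κ)) hV
  have i2 : IntervalIntegrable (fun r => Real.exp (-(2 * κ) * r) * ‖F r‖ ^ 2) volume a b :=
    ContinuousOn.intervalIntegrable (by fun_prop)
  rw [intervalIntegral.integral_congr_ae hd,
    intervalIntegral.integral_sub (i1.const_mul 2) (i2.const_mul _),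
    intervalIntegral.integral_const_mul, intervalIntegral.integral_const_mul] at key
  have p1 : 0 ≤ ∫ r in a..b, Real.exp (-(2 * κ) * r) * ‖F r‖ ^ 2 :=
    intervalIntegral.integral_nonneg hab fun r _ => by positivity
  have p2 : ‖∫ s in a..a, V s‖ = 0 := by simp
  rw [p2] at key
  have p3 : 0 ≤ Real.exp (-(2 * κ) * b) * (‖∫ s in a..b, V s‖ * ‖∫ s in a..b, V s‖) := by positivity
  have p4 := mul_nonneg hκ p1
  linarith

/-- The weighted energy inequality for `y' + μ G*G u + memory = f` tested with `y`, in which the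
memory term has been dropped by positivity. -/
theorem weighted_energy_inequality {X E : Type*} [NormedAddCommGroup X] [InnerProductSpace ℝ X]
    [NormedAddCommGroup E] [InnerProductSpace ℝ E] [CompleteSpace E] (G : X →L[ℝ] E)
    {μ γ δ α M C a b : ℝ} (hμ : 0 < μ) (hγ : 0 ≤ γ) (hα : α ≤ δ) (hM : 0 ≤ M)
    (hab : a ≤ b) {u y : ℝ → X}
    (hu : MemLp u 2 (volume.restrict (Ioc a b))) (hy : ContinuousOn y (Icc a b))
    (hP : ∀ t ∈ Ioo a b, ‖u t‖ ≤ C * ‖G (u t)‖)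
    (hd : ∀ t ∈ Ioo a b, ∃ y', HasDerivAt y y' t ∧
      inner ℝ y' (y t) + μ * ‖G (u t)‖ ^ 2
        + ∫ s in a..t, kernel γ δ (t - s) * inner ℝ (G (u s)) (G (u t)) ≤ M * ‖u t‖) :
    Real.exp (2 * α * b) * ‖y b‖ ^ 2 + μ * ∫ s in a..b, Real.exp (2 * α * s) * ‖G (u s)‖ ^ 2 ≤
      Real.exp (2 * α * a) * ‖y a‖ ^ 2 + 2 * α * (∫ s in a..b, Real.exp (2 * α * s) * ‖y s‖ ^ 2)
        + M ^ 2 * C ^ 2 / μ * ∫ s in a..b, Real.exp (2 * α * s) := by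
  set κ := δ - α with hκ
  -- The kernel factors as `γ exp(-2δt) exp(δt) exp(δs)`, so the memory term is `γ exp(-2δt) ⟨∫ V, V
  -- t⟩`. Multiplying by the weight `exp(2αt)` turns the prefactor into `exp(-2κt)` with `κ = δ - α
  -- ≥ 0`, where the positivity applies.
  set V : ℝ → E := fun s => Real.exp (δ * s) • G (u s) with hVdef
  have hGu : MemLp (fun s => G (u s)) 2 (volume.restrict (Ioc a b)) := G.comp_memLp' hu
  have hGi : IntervalIntegrable (fun s => G (u s)) volume a b := by
    rw [intervalIntegrable_iff_integrableOn_Ioc_of_le hab]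
    exact hGu.integrable (by norm_num)
  have hV : IntervalIntegrable V volume a b := hGi.continuousOn_smul (by fun_prop)
  have hpos := intervalIntegral_exp_mul_inner_primitive_nonneg hab (sub_nonneg.2 hα) hV
  have hmem : ∀ t ∈ Ioo a b,
      ∫ s in a..t, kernel γ δ (t - s) * inner ℝ (G (u s)) (G (u t)) =
        γ * (Real.exp (-(2 * δ) * t) * inner ℝ (∫ s in a..t, V s) (V t)) := by
    intro t ht
    have hVt : IntervalIntegrable V volume a t :=
      hV.mono_set (uIcc_subset_uIcc left_mem_uIcc (Icc_subset_uIcc ⟨ht.1.le, ht.2.le⟩))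
    have h1 := ContinuousLinearMap.intervalIntegral_comp_comm (innerSL ℝ (V t)) hVt
    simp only [innerSL_apply_apply] at h1
    rw [real_inner_comm, ← h1, ← intervalIntegral.integral_const_mul,
      ← intervalIntegral.integral_const_mul]
    refine intervalIntegral.integral_congr fun s _ => ?_
    simp only [hVdef, kernel, inner_smul_left, inner_smul_right, RCLike.conj_to_real]
    rw [real_inner_comm, show -δ * (t - s) = -(2 * δ) * t + δ * t + δ * s by ring, Real.exp_add,
      Real.exp_add]
    ring
  have i1 := intervalIntegrable_exp_mul_inner_primitive (c := -(2 * κ)) hV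
  have i2 : IntervalIntegrable (fun s => Real.exp (2 * α * s) * ‖G (u s)‖ ^ 2) volume a b := by
    refine IntervalIntegrable.continuousOn_mul ?_ (by fun_prop)
    rw [intervalIntegrable_iff_integrableOn_Ioc_of_le hab]
    exact hGu.integrable_norm_pow (by norm_num)
  have i3 : IntervalIntegrable (fun s => Real.exp (2 * α * s) * ‖y s‖ ^ 2) volume a b := by
    refine ContinuousOn.intervalIntegrable ?_
    rw [uIcc_of_le hab]
    fun_prop
  have i4 : IntervalIntegrable (fun s => Real.exp (2 * α * s)) volume a b :=
    (Continuous.intervalIntegrable (by fun_prop) _ _)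
  have i5 := (((i3.const_mul (2 * α)).add (i4.const_mul (M ^ 2 * C ^ 2 / μ))).sub
    (i2.const_mul μ)).sub (i1.const_mul (2 * γ))
  choose! y' hy' using hd
  -- Nothing is known about integrability of `y'`. This one-sided form of the fundamental theorem
  -- only needs an integrable upper bound for the derivative.
  have main := intervalIntegral.sub_le_integral_of_hasDeriv_right_of_le hab
    (g := fun t => Real.exp (2 * α * t) * ‖y t‖ ^ 2)
    (g' := fun t => Real.exp (2 * α * t) * (2 * α) * ‖y t‖ ^ 2
      + Real.exp (2 * α * t) * (2 * inner ℝ (y t) (y' t)))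
    (by fun_prop) (fun t ht => ?_)
    ((intervalIntegrable_iff_integrableOn_Icc_of_le hab).1 i5) (fun t ht => ?_)
  · rw [intervalIntegral.integral_sub (((i3.const_mul _).add (i4.const_mul _)).sub
      (i2.const_mul _)) (i1.const_mul _),
      intervalIntegral.integral_sub ((i3.const_mul _).add (i4.const_mul _)) (i2.const_mul _),
      intervalIntegral.integral_add (i3.const_mul _) (i4.const_mul _),
      intervalIntegral.integral_const_mul, intervalIntegral.integral_const_mul,
      intervalIntegral.integral_const_mul, intervalIntegral.integral_const_mul] at main
    have := mul_nonneg (mul_nonneg zero_le_two hγ) hpos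
    linarith
  · have h3 : HasDerivAt (fun x => Real.exp (2 * α * x)) (Real.exp (2 * α * t) * (2 * α)) t := by
      simpa using ((hasDerivAt_id t).const_mul (2 * α)).exp
    exact (h3.mul (hy' t ht).1.norm_sq).hasDerivWithinAt
  · have h1 := (hy' t ht).2
    rw [hmem t ht, real_inner_comm] at h1
    have h2 := mul_le_mul_of_nonneg_left (hP t ht) hM
    -- Young's inequality: the force consumes one of the two copies of `μ ‖G u‖²`.
    have h3 : 2 * (M * (C * ‖G (u t)‖)) ≤ M ^ 2 * C ^ 2 / μ + μ * ‖G (u t)‖ ^ 2 := by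
      have : M ^ 2 * C ^ 2 / μ + μ * ‖G (u t)‖ ^ 2 - 2 * (M * (C * ‖G (u t)‖))
          = (M * C - μ * ‖G (u t)‖) ^ 2 / μ := by field_simp; ring
      have : 0 ≤ (M * C - μ * ‖G (u t)‖) ^ 2 / μ := by positivity
      linarith
    have h4 : 2 * inner ℝ (y t) (y' t) ≤ M ^ 2 * C ^ 2 / μ - μ * ‖G (u t)‖ ^ 2
        - 2 * (γ * (Real.exp (-(2 * δ) * t) * inner ℝ (∫ s in a..t, V s) (V t))) := by linarith
    have h5 := mul_le_mul_of_nonneg_left h4 (Real.exp_pos (2 * α * t)).le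
    have h6 : Real.exp (-(2 * κ) * t) = Real.exp (2 * α * t) * Real.exp (-(2 * δ) * t) := by
      rw [← Real.exp_add, hκ]; ring_nf
    simp only [h6]
    linarith

theorem integral_exp_two_mul {α a b : ℝ} (hα : α ≠ 0) :
    ∫ s in a..b, Real.exp (2 * α * s)
      = (Real.exp (2 * α * b) - Real.exp (2 * α * a)) / (2 * α) := by
  rw [intervalIntegral.integral_comp_mul_left _ (by simpa using hα), integral_exp, smul_eq_mul]
  field_simp

/-- Uniform bound for `y`, from the weighted energy inequality with a small weight. -/
theorem norm_sq_le_of_energy {X E : Type*} [NormedAddCommGroup X] [InnerProductSpace ℝ X]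
    [NormedAddCommGroup E] [InnerProductSpace ℝ E] [CompleteSpace E] (G : X →L[ℝ] E)
    {μ γ δ α M C a b : ℝ} (hμ : 0 < μ) (hγ : 0 ≤ γ) (hα₀ : 0 < α) (hα : α ≤ δ) (hM : 0 ≤ M)
    (hαC : 2 * α * C ^ 2 ≤ μ) (hab : a ≤ b) {u y : ℝ → X}
    (hu : MemLp u 2 (volume.restrict (Ioc a b))) (hy : ContinuousOn y (Icc a b))
    (hyu : ∀ t ∈ Ioo a b, ‖y t‖ ≤ ‖u t‖)
    (hP : ∀ t ∈ Ioo a b, ‖u t‖ ≤ C * ‖G (u t)‖)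
    (hd : ∀ t ∈ Ioo a b, ∃ y', HasDerivAt y y' t ∧
      inner ℝ y' (y t) + μ * ‖G (u t)‖ ^ 2
        + ∫ s in a..t, kernel γ δ (t - s) * inner ℝ (G (u s)) (G (u t)) ≤ M * ‖u t‖) :
    ‖y b‖ ^ 2 ≤ ‖y a‖ ^ 2 + M ^ 2 * C ^ 2 / μ / (2 * α) := by
  have key := weighted_energy_inequality G hμ hγ hα hM hab hu hy hP hd
  have i2 : IntervalIntegrable (fun s => Real.exp (2 * α * s) * ‖G (u s)‖ ^ 2) volume a b := by
    refine IntervalIntegrable.continuousOn_mul ?_ (by fun_prop)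
    rw [intervalIntegrable_iff_integrableOn_Ioc_of_le hab]
    exact (G.comp_memLp' hu).integrable_norm_pow (by norm_num)
  have i3 : IntervalIntegrable (fun s => Real.exp (2 * α * s) * ‖y s‖ ^ 2) volume a b := by
    refine ContinuousOn.intervalIntegrable ?_
    rw [uIcc_of_le hab]
    fun_prop
  -- The weight is small enough (`2αC² ≤ μ`) for its own derivative term to be absorbed by the
  -- dissipation, via `‖y‖ ≤ ‖u‖ ≤ C ‖G u‖`.
  have h1 : 2 * α * (∫ s in a..b, Real.exp (2 * α * s) * ‖y s‖ ^ 2)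
      ≤ μ * ∫ s in a..b, Real.exp (2 * α * s) * ‖G (u s)‖ ^ 2 := by
    rw [← intervalIntegral.integral_const_mul, ← intervalIntegral.integral_const_mul]
    refine intervalIntegral.integral_mono_on_of_le_Ioo hab (i3.const_mul _) (i2.const_mul _)
      fun s hs => ?_
    have h2 : ‖y s‖ ^ 2 ≤ (C * ‖G (u s)‖) ^ 2 :=
      pow_le_pow_left₀ (norm_nonneg _) ((hyu s hs).trans (hP s hs)) 2
    have h3 : 2 * α * ‖y s‖ ^ 2 ≤ μ * ‖G (u s)‖ ^ 2 := by
      calc 2 * α * ‖y s‖ ^ 2 ≤ 2 * α * (C * ‖G (u s)‖) ^ 2 := by gcongr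
        _ = 2 * α * C ^ 2 * ‖G (u s)‖ ^ 2 := by ring
        _ ≤ _ := by gcongr
    have := mul_le_mul_of_nonneg_left h3 (Real.exp_pos (2 * α * s)).le
    linarith
  rw [integral_exp_two_mul hα₀.ne'] at key
  have hD : 0 ≤ M ^ 2 * C ^ 2 / μ / (2 * α) := by positivity
  have hle : Real.exp (2 * α * a) ≤ Real.exp (2 * α * b) := by gcongr
  have ha := Real.exp_pos (2 * α * a)
  have hb := Real.exp_pos (2 * α * b)
  refine le_of_mul_le_mul_left ?_ hb
  have e : M ^ 2 * C ^ 2 / μ * ((Real.exp (2 * α * b) - Real.exp (2 * α * a)) / (2 * α))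
    = M ^ 2 * C ^ 2 / μ / (2 * α) * (Real.exp (2 * α * b) - Real.exp (2 * α * a)) := by ring
  rw [e] at key
  nlinarith [mul_nonneg hD ha.le, mul_le_mul_of_nonneg_right hle (sq_nonneg ‖y a‖)]

/-- Bound for the exponentially weighted dissipation when `y` is bounded. -/
theorem exp_mul_integral_le_of_energy {X E : Type*} [NormedAddCommGroup X] [InnerProductSpace ℝ X]
    [NormedAddCommGroup E] [InnerProductSpace ℝ E] [CompleteSpace E] (G : X →L[ℝ] E)
    {μ γ δ α M C a b B : ℝ} (hμ : 0 < μ) (hγ : 0 ≤ γ) (hα₀ : 0 < α) (hα : α ≤ δ) (hM : 0 ≤ M)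
    (hab : a ≤ b) {u y : ℝ → X}
    (hu : MemLp u 2 (volume.restrict (Ioc a b))) (hy : ContinuousOn y (Icc a b))
    (hB : ∀ t ∈ Icc a b, ‖y t‖ ^ 2 ≤ B)
    (hP : ∀ t ∈ Ioo a b, ‖u t‖ ≤ C * ‖G (u t)‖)
    (hd : ∀ t ∈ Ioo a b, ∃ y', HasDerivAt y y' t ∧
      inner ℝ y' (y t) + μ * ‖G (u t)‖ ^ 2
        + ∫ s in a..t, kernel γ δ (t - s) * inner ℝ (G (u s)) (G (u t)) ≤ M * ‖u t‖) :
    Real.exp (-2 * α * b) * ∫ s in a..b, Real.exp (2 * α * s) * ‖G (u s)‖ ^ 2 ≤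
      (B + M ^ 2 * C ^ 2 / μ / (2 * α)) / μ := by
  have key := weighted_energy_inequality G hμ hγ hα hM hab hu hy hP hd
  have i3 : IntervalIntegrable (fun s => Real.exp (2 * α * s) * ‖y s‖ ^ 2) volume a b := by
    refine ContinuousOn.intervalIntegrable ?_
    rw [uIcc_of_le hab]
    fun_prop
  -- Here `α` need not be small against `μ`: the weight term is controlled by the bound `B` and no
  -- dissipation is spent on it.
  have h1 : ∫ s in a..b, Real.exp (2 * α * s) * ‖y s‖ ^ 2
      ≤ ∫ s in a..b, Real.exp (2 * α * s) * B := by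
    refine intervalIntegral.integral_mono_on hab i3
      (Continuous.intervalIntegrable (by fun_prop) _ _) fun s hs => ?_
    gcongr
    exact hB s hs
  rw [intervalIntegral.integral_mul_const, integral_exp_two_mul hα₀.ne'] at h1
  rw [integral_exp_two_mul hα₀.ne'] at key
  set A := Real.exp (2 * α * a) with hA
  have ha := Real.exp_pos (2 * α * a)
  have hb := Real.exp_pos (2 * α * b)
  have hD : 0 ≤ M ^ 2 * C ^ 2 / μ / (2 * α) := by positivity
  have e : M ^ 2 * C ^ 2 / μ * ((Real.exp (2 * α * b) - A) / (2 * α))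
    = M ^ 2 * C ^ 2 / μ / (2 * α) * (Real.exp (2 * α * b) - A) := by ring
  have e2 : 2 * α * ((Real.exp (2 * α * b) - A) / (2 * α) * B) = (Real.exp (2 * α * b) - A) * B := by
    field_simp
  have h2 := mul_le_mul_of_nonneg_left h1 (by positivity : 0 ≤ 2 * α)
  rw [e] at key
  rw [e2] at h2
  have h3 := mul_le_mul_of_nonneg_left (hB a (left_mem_Icc.2 hab)) ha.le
  rw [le_div_iff₀ hμ, show -2 * α * b = -(2 * α * b) by ring, Real.exp_neg,
    inv_mul_eq_div, div_mul_eq_mul_div, div_le_iff₀ hb]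
  have h4 : 0 ≤ Real.exp (2 * α * b) * ‖y b‖ ^ 2 := by positivity
  nlinarith [mul_nonneg hD ha.le]

/-! ### Sobolev inequalities on `H¹₀(Ω)` -/

theorem norm_fderiv_le_sum_classicalPd (φ : Plane → ℝ) (x : Plane) :
    ‖fderiv ℝ φ x‖ ≤ ∑ j, ‖classicalPd j φ x‖ := by
  refine ContinuousLinearMap.opNorm_le_bound _ (by positivity) fun v => ?_
  have hv : v = ∑ j, v j • EuclideanSpace.single j (1 : ℝ) := by
    ext i
    fin_cases i <;> simp
  have e : fderiv ℝ φ x v = ∑ j, v j * classicalPd j φ x := by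
    conv_lhs => rw [hv]
    simp [classicalPd]
  rw [e, Finset.sum_mul]
  refine (norm_sum_le _ _).trans (Finset.sum_le_sum fun j _ => ?_)
  rw [norm_mul, mul_comm]
  gcongr
  exact PiLp.norm_apply_le v j

noncomputable section

namespace Oldroyd

variable {Ω : PlanarDomain}

theorem IsTest.continuous_classicalPd {φ : Plane → ℝ} (hφ : IsTest Ω φ) (j : Fin 2) :
    Continuous (classicalPd j φ) :=
  (hφ.1.continuous_fderiv (by simp)).clm_apply continuous_const

theorem IsTest.hasCompactSupport_classicalPd {φ : Plane → ℝ} (hφ : IsTest Ω φ) (j : Fin 2) :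
    HasCompactSupport (classicalPd j φ) :=
  hφ.2.1.fderiv_apply (𝕜 := ℝ) (EuclideanSpace.single j 1)

theorem IsTest.memLp {φ : Plane → ℝ} (hφ : IsTest Ω φ) (p : ENNReal) : MemLp φ p (vol Ω) :=
  hφ.1.continuous.memLp_of_hasCompactSupport hφ.2.1

theorem IsTest.memLp_classicalPd {φ : Plane → ℝ} (hφ : IsTest Ω φ) (j : Fin 2) (p : ENNReal) :
    MemLp (classicalPd j φ) p (vol Ω) :=
  (hφ.continuous_classicalPd j).memLp_of_hasCompactSupport (hφ.hasCompactSupport_classicalPd j)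

theorem IsTest.eLpNorm_fderiv_le {φ : Plane → ℝ} (hφ : IsTest Ω φ) :
    eLpNorm (fderiv ℝ φ) 2 (vol Ω) ≤ ∑ j, eLpNorm (classicalPd j φ) 2 (vol Ω) := by
  calc eLpNorm (fderiv ℝ φ) 2 (vol Ω)
      ≤ eLpNorm (fun x => ∑ j, ‖classicalPd j φ x‖) 2 (vol Ω) := by
        refine eLpNorm_mono fun x => ?_
        rw [Real.norm_of_nonneg (by positivity)]
        exact norm_fderiv_le_sum_classicalPd φ x
    _ ≤ ∑ j, eLpNorm (fun x => ‖classicalPd j φ x‖) 2 (vol Ω) := by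
        have := eLpNorm_sum_le (μ := vol Ω) (p := 2) (s := Finset.univ)
          (f := fun j x => ‖classicalPd j φ x‖)
          (fun j _ => (hφ.continuous_classicalPd j).norm.aestronglyMeasurable) (by norm_num)
        convert this using 2
        ext x; simp
    _ = _ := by simp only [eLpNorm_norm]

/-- The Sobolev embedding of `W^{1,1}` in the plane, where the conjugate exponent of the dimension
is `2`. Both the Poincaré and the Ladyzhenskaya inequality follow from it. -/
theorem exists_gagliardo_nirenberg_test (Ω : PlanarDomain) : ∃ C : NNReal, ∀ ψ : Plane → ℝ,
    IsTest Ω ψ → eLpNorm ψ 2 (vol Ω) ≤ C * eLpNorm (fderiv ℝ ψ) 1 (vol Ω) := by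
  refine ⟨eLpNormLESNormFDerivOneConst (volume : Measure Plane) ((2 : NNReal) : ℝ), fun ψ hψ => ?_⟩
  have hp : NNReal.HolderConjugate (Module.finrank ℝ Plane) 2 := by
    rw [show Module.finrank ℝ Plane = 2 by simp]
    norm_num
    exact NNReal.HolderConjugate.two_two
  have h : eLpNorm ψ ((2 : NNReal) : ENNReal) volume ≤ _ :=
    eLpNorm_le_eLpNorm_fderiv_one (volume : Measure Plane) (hψ.1.of_le (by simp)) hψ.2.1 hp
  have hs : Function.support (fun x => ‖fderiv ℝ ψ x‖) ⊆ Ω.carrier := by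
    intro x hx
    refine hψ.2.2 (support_fderiv_subset ℝ (Function.mem_support.2 fun hx' => ?_))
    exact hx (by simp [hx'])
  have hr := eLpNorm_restrict_eq_of_support_subset (p := 1) (μ := volume) hs
  rw [eLpNorm_norm, eLpNorm_norm] at hr
  rw [← hr] at h
  exact (eLpNorm_mono_measure _ Measure.restrict_le_self).trans h

theorem IsTest.sq {φ : Plane → ℝ} (hφ : IsTest Ω φ) : IsTest Ω (fun x => φ x ^ 2) := by
  refine ⟨hφ.1.pow 2, ?_, ?_⟩
  · exact hφ.2.1.comp_left (g := fun t : ℝ => t ^ 2) (by simp)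
  · refine (closure_mono ?_).trans hφ.2.2
    intro x hx
    simp only [Function.mem_support] at hx ⊢
    intro h; exact hx (by simp [h])

/-- Ladyzhenskaya's inequality for test functions. -/
theorem exists_ladyzhenskaya_test (Ω : PlanarDomain) : ∃ C : NNReal, ∀ φ : Plane → ℝ,
    IsTest Ω φ → eLpNorm φ 4 (vol Ω) ^ 2 ≤
      C * 2 * (eLpNorm φ 2 (vol Ω) * ∑ j, eLpNorm (classicalPd j φ) 2 (vol Ω)) := by
  obtain ⟨C, hC⟩ := exists_gagliardo_nirenberg_test Ω
  refine ⟨C, fun φ hφ => ?_⟩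
  -- For `φ²` the left side is `‖φ‖₄²`, while the gradient `2 φ ∇φ` is estimated in `L¹` by
  -- Cauchy–Schwarz.
  have h := hC _ hφ.sq
  have e1 : eLpNorm (fun x => φ x ^ 2) 2 (vol Ω) = eLpNorm φ 4 (vol Ω) ^ 2 := by
    have := eLpNorm_norm_rpow (μ := vol Ω) (p := 2) φ (q := 2) (by norm_num)
    rw [show (2 : ENNReal) * ENNReal.ofReal 2 = 4 by norm_num] at this
    rw [← ENNReal.rpow_two, ← this]
    congr 1
    ext x; simp
  have e2 : fderiv ℝ (fun x => φ x ^ 2) = fun x => (2 * φ x) • fderiv ℝ φ x := by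
    ext1 x
    rw [fderiv_fun_pow 2 (hφ.1.differentiable (by simp) x)]
    simp
  have h2 : eLpNorm (fderiv ℝ (fun x => φ x ^ 2)) 1 (vol Ω) ≤
      2 * (eLpNorm φ 2 (vol Ω) * eLpNorm (fderiv ℝ φ) 2 (vol Ω)) := by
    rw [e2]
    have := eLpNorm_smul_le_mul_eLpNorm (μ := vol Ω) (p := 2) (q := 2) (r := 1)
      (f := fderiv ℝ φ) (φ := fun x => 2 * φ x)
      (hφ.1.continuous_fderiv (by simp)).aestronglyMeasurable
      (by have := hφ.1.continuous; fun_prop)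
    refine this.trans_eq ?_
    have := eLpNorm_const_smul (2 : ℝ) φ 2 (vol Ω)
    rw [show (fun x => 2 * φ x) = (2 : ℝ) • φ from rfl, this, mul_assoc]
    simp [enorm_eq_nnnorm]
  rw [e1] at h
  refine h.trans ?_
  rw [mul_assoc]
  gcongr
  refine h2.trans ?_
  gcongr
  exact hφ.eLpNorm_fderiv_le

instance (Ω : PlanarDomain) : IsFiniteMeasure (vol Ω) :=
  ⟨by simpa using Ω.isBounded.measure_lt_top⟩

/-- The Poincaré inequality for test functions. -/
theorem exists_poincare_test (Ω : PlanarDomain) : ∃ C : NNReal, ∀ φ : Plane → ℝ, IsTest Ω φ →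
    eLpNorm φ 2 (vol Ω) ≤ C * ∑ j, eLpNorm (classicalPd j φ) 2 (vol Ω) := by
  obtain ⟨C, hC⟩ := exists_gagliardo_nirenberg_test Ω
  refine ⟨C * ((vol Ω) univ ^ (1 / 2 : ℝ)).toNNReal, fun φ hφ => ?_⟩
  -- Hölder on the bounded domain replaces the `L¹` norm of the gradient by its `L²` norm, at the
  -- cost of `|Ω|^{1/2}`.
  have h := eLpNorm_le_eLpNorm_mul_rpow_measure_univ (μ := vol Ω) (p := 1) (q := 2)
    (f := fderiv ℝ φ) (by norm_num) (hφ.1.continuous_fderiv (by simp)).aestronglyMeasurable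
  have e : ((1 : ENNReal).toReal⁻¹ - (2 : ENNReal).toReal⁻¹ : ℝ) = 1 / 2 := by norm_num
  simp only [one_div, ENNReal.toReal_one, inv_one, ENNReal.toReal_ofNat] at h e
  rw [e] at h
  refine (hC φ hφ).trans ?_
  rw [ENNReal.coe_mul, ENNReal.coe_toNNReal (ENNReal.rpow_ne_top_of_nonneg (by norm_num)
    (measure_ne_top _ _)), mul_assoc]
  gcongr
  refine h.trans ?_
  rw [mul_comm, one_div]
  gcongr
  exact hφ.eLpNorm_fderiv_le

/-- A function of `H¹₀(Ω)` is the limit of test functions, as elements of `L²(Ω)`, together with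
its first derivatives. -/
theorem MemH10.exists_seq {u : L2 Ω} (hu : MemH10 u) :
    ∃ (φ : ℕ → Plane → ℝ) (hφ : ∀ n, IsTest Ω (φ n)),
      Tendsto (fun n => ((hφ n).memLp 2).toLp (φ n)) atTop (𝓝 u) ∧
      ∀ j, Tendsto (fun n => ((hφ n).memLp_classicalPd j 2).toLp (classicalPd j (φ n))) atTop
        (𝓝 (pd j u)) := by
  obtain ⟨-, φ, hφ, h0, h1⟩ := hu
  refine ⟨φ, hφ, ?_, fun j => ?_⟩
  · rw [← Lp.toLp_coeFn u (Lp.memLp u), Lp.tendsto_Lp_iff_tendsto_eLpNorm'']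
    refine h0.congr fun n => ?_
    rw [eLpNorm_sub_comm]; rfl
  · rw [← Lp.toLp_coeFn (pd j u) (Lp.memLp _), Lp.tendsto_Lp_iff_tendsto_eLpNorm'']
    refine (h1 j).congr fun n => ?_
    rw [eLpNorm_sub_comm]; rfl

/-- The Poincaré inequality on `H¹₀(Ω)`. -/
theorem exists_poincare (Ω : PlanarDomain) : ∃ C : ℝ, 0 ≤ C ∧ ∀ u : L2 Ω, MemH10 u →
    ‖u‖ ≤ C * ∑ j, ‖pd j u‖ := by
  obtain ⟨C, hC⟩ := exists_poincare_test Ω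
  refine ⟨C, C.2, fun u hu => ?_⟩
  obtain ⟨φ, hφ, h0, h1⟩ := hu.exists_seq
  refine le_of_tendsto_of_tendsto' h0.norm
    (tendsto_const_nhds.mul (tendsto_finsetSum _ fun j _ => (h1 j).norm)) fun n => ?_
  have h := hC (φ n) (hφ n)
  simp only [Lp.norm_toLp]
  have h' := ENNReal.toReal_mono ?_ h
  · rw [ENNReal.toReal_mul, ENNReal.toReal_sum fun j _ => ((hφ n).memLp_classicalPd j 2).2.ne] at h'
    exact h'
  · refine ENNReal.mul_ne_top (by simp) ?_
    exact (ENNReal.sum_lt_top.2 fun j _ => ((hφ n).memLp_classicalPd j 2).2).ne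

/-- Ladyzhenskaya's inequality on `H¹₀(Ω)`. -/
theorem exists_ladyzhenskaya (Ω : PlanarDomain) : ∃ C : ℝ, 0 ≤ C ∧ ∀ u : L2 Ω, MemH10 u →
    eLpNorm u 4 (vol Ω) ≤ ENNReal.ofReal √(C * (‖u‖ * ∑ j, ‖pd j u‖)) := by
  obtain ⟨C₀, hC₀⟩ := exists_ladyzhenskaya_test Ω
  refine ⟨C₀ * 2, by positivity, fun u hu => ?_⟩
  set C : ℝ := C₀ * 2 with hCdef
  obtain ⟨φ, hφ, h0, h1⟩ := hu.exists_seq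
  -- Convergence in `L²` does not give convergence in `L⁴`. Along an almost everywhere convergent
  -- subsequence the `L⁴` norm is lower semicontinuous, which is enough.
  obtain ⟨ns, hns, hae⟩ := (tendstoInMeasure_of_tendsto_Lp h0).exists_seq_tendsto_ae
  have hlim : ∀ᵐ x ∂(vol Ω), Tendsto (fun k => φ (ns k) x) atTop (𝓝 (u x)) := by
    have := ae_all_iff.2 fun k => ((hφ (ns k)).memLp 2).coeFn_toLp
    filter_upwards [hae, this] with x hx hx'
    exact hx.congr fun k => hx' k
  refine (Lp.eLpNorm_lim_le_liminf_eLpNorm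
    (fun k => (hφ (ns k)).1.continuous.aestronglyMeasurable) u hlim).trans ?_
  have hb : ∀ n, eLpNorm (φ n) 4 (vol Ω) ≤ ENNReal.ofReal √(C *
      (‖((hφ n).memLp 2).toLp (φ n)‖ *
        ∑ j, ‖((hφ n).memLp_classicalPd j 2).toLp (classicalPd j (φ n))‖)) := by
    intro n
    have h := hC₀ _ (hφ n)
    have h4 : eLpNorm (φ n) 4 (vol Ω) ≠ ⊤ := ((hφ n).memLp 4).2.ne
    rw [← ENNReal.ofReal_toReal h4]
    refine ENNReal.ofReal_le_ofReal (Real.le_sqrt_of_sq_le ?_)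
    have hs : ∑ j, eLpNorm (classicalPd j (φ n)) 2 (vol Ω) ≠ ⊤ :=
      (ENNReal.sum_lt_top.2 fun j _ => ((hφ n).memLp_classicalPd j 2).2).ne
    have h' := ENNReal.toReal_mono ?_ h
    · rw [ENNReal.toReal_pow, ENNReal.toReal_mul, ENNReal.toReal_mul, ENNReal.toReal_mul,
        ENNReal.toReal_sum fun j _ => ((hφ n).memLp_classicalPd j 2).2.ne] at h'
      simpa [Lp.norm_toLp] using h'
    · exact ENNReal.mul_ne_top (ENNReal.mul_ne_top (by simp) (by simp))
        (ENNReal.mul_ne_top ((hφ n).memLp 2).2.ne hs)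
  have ht : Tendsto (fun n => ENNReal.ofReal √(C *
      (‖((hφ n).memLp 2).toLp (φ n)‖ *
        ∑ j, ‖((hφ n).memLp_classicalPd j 2).toLp (classicalPd j (φ n))‖))) atTop
      (𝓝 (ENNReal.ofReal √(C * (‖u‖ * ∑ j, ‖pd j u‖)))) := by
    refine ENNReal.tendsto_ofReal (Real.continuous_sqrt.continuousAt.tendsto.comp ?_)
    exact tendsto_const_nhds.mul (h0.norm.mul (tendsto_finsetSum _ fun j _ => (h1 j).norm))
  rw [← (ht.comp hns.tendsto_atTop).liminf_eq]
  exact liminf_le_liminf (Eventually.of_forall fun k => hb (ns k))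

/-- Derivatives of functions of `H¹₀(Ω)` have mean value zero. -/
theorem MemH10.integral_pd {u : L2 Ω} (hu : MemH10 u) (j : Fin 2) : ∫ x, pd j u x ∂(vol Ω) = 0 := by
  obtain ⟨φ, hφ, -, h1⟩ := hu.exists_seq
  -- On a domain of finite measure the integral is the pairing with the constant `1`, hence
  -- continuous on `L²`, so it can be computed along test functions.
  have hc : MemLp (fun _ : Plane => (1 : ℝ)) 2 (vol Ω) := memLp_const 1
  have e : ∀ g : L2 Ω, inner ℝ (hc.toLp _) g = ∫ x, g x ∂(vol Ω) := by
    intro g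
    rw [L2.inner_def]
    refine integral_congr_ae ?_
    filter_upwards [hc.coeFn_toLp] with x hx
    rw [hx]
    simp
  rw [← e]
  refine tendsto_nhds_unique (tendsto_const_nhds.inner (h1 j)) ?_
  refine tendsto_const_nhds.congr fun n => ?_
  rw [e, integral_congr_ae ((hφ n).memLp_classicalPd j 2).coeFn_toLp]
  have hs : Function.support (classicalPd j (φ n)) ⊆ Ω.carrier := by
    refine subset_trans ?_ ((support_fderiv_subset ℝ).trans (hφ n).2.2)
    intro x hx hx'
    exact hx (by simp [classicalPd, hx'])
  rw [setIntegral_eq_integral_of_forall_compl_eq_zero fun x hx => by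
    by_contra h; exact hx (hs h)]
  have hi : Integrable (classicalPd j (φ n)) volume :=
    ((hφ n).continuous_classicalPd j).integrable_of_hasCompactSupport
      ((hφ n).hasCompactSupport_classicalPd j)
  have hi' : Integrable (φ n) volume :=
    (hφ n).1.continuous.integrable_of_hasCompactSupport (hφ n).2.1
  have := integral_mul_fderiv_eq_neg_fderiv_mul_of_integrable (μ := (volume : Measure Plane))
    (f := fun _ : Plane => (1 : ℝ)) (g := φ n) (v := EuclideanSpace.single j 1) (by simp)
    (by simpa using! hi) (by simpa using hi')
    (by fun_prop) (fun x _ => (hφ n).1.differentiable (by simp) x)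
  simpa [classicalPd] using this.symm

/-! ### The gradient -/

theorem gradNorm_nonneg (v : VL2 Ω) : 0 ≤ gradNorm v := Real.sqrt_nonneg _

theorem a_self (v : VL2 Ω) : a v v = gradNorm v ^ 2 := by
  rw [gradNorm, Real.sq_sqrt (by positivity)]
  simp only [a, real_inner_self_eq_norm_sq]

theorem norm_pd_le_gradNorm (v : VL2 Ω) (i j : Fin 2) : ‖pd j (v i)‖ ≤ gradNorm v := by
  refine Real.le_sqrt_of_sq_le ?_
  refine (Finset.single_le_sum (f := fun j => ‖pd j (v i)‖ ^ 2) (fun _ _ => by positivity)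
    (Finset.mem_univ j)).trans ?_
  exact Finset.single_le_sum (f := fun i => ∑ j, ‖pd j (v i)‖ ^ 2) (fun _ _ => by positivity)
    (Finset.mem_univ i)

theorem norm_divergence_le (v : VL2 Ω) : ‖divergence v‖ ≤ 2 * gradNorm v := by
  refine (norm_sum_le _ _).trans ((Finset.sum_le_sum fun i _ => norm_pd_le_gradNorm v i i).trans ?_)
  simp

theorem MemH10.pd_add {u v : L2 Ω} (hu : MemH10 u) (hv : MemH10 v) (j : Fin 2) :
    pd j (u + v) = pd j u + pd j v :=
  ((hu.1.hasWeakPd j).add (hv.1.hasWeakPd j)).pd_eq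

theorem MemH10.pd_smul {u : L2 Ω} (hu : MemH10 u) (c : ℝ) (j : Fin 2) :
    pd j (c • u) = c • pd j u :=
  ((hu.1.hasWeakPd j).smul c).pd_eq

/-- On a finite element space the gradient is a continuous linear map; it is extended to `𝐋²`. -/
theorem FEPair.exists_gradient (S : FEPair Ω) :
    ∃ G : VL2 Ω →L[ℝ] PiLp 2 (fun _ : Fin 2 × Fin 2 => L2 Ω), ∀ v ∈ S.velocity,
      ∀ p, G v p = pd p.2 (v p.1) := by
  have := S.finiteVelocity
  let g : S.velocity →ₗ[ℝ] PiLp 2 (fun _ : Fin 2 × Fin 2 => L2 Ω) :=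
    { toFun := fun v => WithLp.toLp 2 fun p => pd p.2 (v.1 p.1)
      map_add' := fun v w => by
        ext1 p
        exact (S.velocity_mem v.1 v.2 p.1).pd_add (S.velocity_mem w.1 w.2 p.1) p.2
      map_smul' := fun c v => by
        ext1 p
        exact (S.velocity_mem v.1 v.2 p.1).pd_smul c p.2 }
  -- Finite dimension gives continuity, and the orthogonal projection gives the extension. Square
  -- integrability in time of `u^h` thereby passes to its gradient.
  refine ⟨(LinearMap.toContinuousLinearMap g) ∘L S.velocity.orthogonalProjectionOnto, fun v hv p => ?_⟩
  have : S.velocity.orthogonalProjectionOnto v = ⟨v, hv⟩ :=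
    Submodule.orthogonalProjectionOnto_mem_subspace_eq_self (⟨v, hv⟩ : S.velocity)
  simp [this, g]

theorem inner_eq_a {G : VL2 Ω → PiLp 2 (fun _ : Fin 2 × Fin 2 => L2 Ω)} {v w : VL2 Ω}
    (hv : ∀ p, G v p = pd p.2 (v p.1)) (hw : ∀ p, G w p = pd p.2 (w p.1)) :
    inner ℝ (G v) (G w) = a v w := by
  rw [PiLp.inner_apply, Fintype.sum_prod_type]
  simp only [hv, hw, a]

theorem norm_eq_gradNorm {G : VL2 Ω → PiLp 2 (fun _ : Fin 2 × Fin 2 => L2 Ω)} {v : VL2 Ω}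
    (hv : ∀ p, G v p = pd p.2 (v p.1)) : ‖G v‖ = gradNorm v := by
  rw [← sq_eq_sq₀ (norm_nonneg _) (gradNorm_nonneg v), ← real_inner_self_eq_norm_sq,
    inner_eq_a hv hv, a_self]

theorem VMemH10.a_add_left {v w : VL2 Ω} (hv : VMemH10 v) (hw : VMemH10 w) (φ : VL2 Ω) :
    a (v + w) φ = a v φ + a w φ := by
  simp only [a, PiLp.add_apply, (hv _).pd_add (hw _), inner_add_left, Finset.sum_add_distrib]

theorem VMemH10.a_add_right {v w : VL2 Ω} (hv : VMemH10 v) (hw : VMemH10 w) (φ : VL2 Ω) :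
    a φ (v + w) = a φ v + a φ w := by
  simp only [a, PiLp.add_apply, (hv _).pd_add (hw _), inner_add_right, Finset.sum_add_distrib]

theorem abs_a_le (v w : VL2 Ω) : |a v w| ≤ gradNorm v * gradNorm w := by
  have e : ∀ u : VL2 Ω, ‖(WithLp.toLp 2 fun p : Fin 2 × Fin 2 => pd p.2 (u p.1) :
      PiLp 2 (fun _ : Fin 2 × Fin 2 => L2 Ω))‖ = gradNorm u := fun u =>
    norm_eq_gradNorm (G := fun u => WithLp.toLp 2 fun p => pd p.2 (u p.1)) fun _ => rfl
  have h := abs_real_inner_le_norm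
    (WithLp.toLp 2 fun p => pd p.2 (v p.1) : PiLp 2 (fun _ : Fin 2 × Fin 2 => L2 Ω))
    (WithLp.toLp 2 fun p => pd p.2 (w p.1))
  rwa [e, e, inner_eq_a (G := fun u => WithLp.toLp 2 fun p => pd p.2 (u p.1)) (fun _ => rfl)
    fun _ => rfl] at h

/-- The Poincaré inequality on `𝐇¹₀`. -/
theorem exists_vector_poincare (Ω : PlanarDomain) : ∃ C : ℝ, 0 < C ∧ ∀ v : VL2 Ω, VMemH10 v →
    ‖v‖ ≤ C * gradNorm v := by
  obtain ⟨C, hC, h⟩ := exists_poincare Ω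
  refine ⟨4 * C + 1, by positivity, fun v hv => ?_⟩
  have h1 : ∀ i, ‖v i‖ ≤ C * (2 * gradNorm v) := fun i => by
    refine (h _ (hv i)).trans ?_
    gcongr
    refine (Finset.sum_le_sum fun j _ => norm_pd_le_gradNorm v i j).trans_eq ?_
    simp
  have hg := gradNorm_nonneg v
  have h2 : ‖v‖ ≤ ∑ i, ‖v i‖ := by
    refine (sq_le_sq₀ (norm_nonneg _) (by positivity)).1 ?_
    rw [PiLp.norm_sq_eq_of_L2, Fin.sum_univ_two, Fin.sum_univ_two]
    nlinarith [norm_nonneg (v 0), norm_nonneg (v 1)]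
  refine h2.trans ((Finset.sum_le_sum fun i _ => h1 i).trans ?_)
  simp only [Finset.sum_const, Finset.card_univ, Fintype.card_fin, nsmul_eq_mul, Nat.cast_ofNat]
  nlinarith

/-! ### The trilinear form -/

/-- An `L⁴` norm of a vector field. -/
def l4Norm (v : VL2 Ω) : ℝ := ∑ i, (eLpNorm (v i) 4 (vol Ω)).toReal

theorem l4Norm_nonneg (v : VL2 Ω) : 0 ≤ l4Norm v := Finset.sum_nonneg fun _ _ => by positivity

theorem MemH10.memLp_four {u : L2 Ω} (hu : MemH10 u) : MemLp u 4 (vol Ω) := by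
  obtain ⟨C, -, h⟩ := exists_ladyzhenskaya Ω
  exact ⟨Lp.aestronglyMeasurable u, (h u hu).trans_lt (by simp)⟩

/-- Ladyzhenskaya's inequality on `𝐇¹₀`. -/
theorem exists_vector_ladyzhenskaya (Ω : PlanarDomain) : ∃ C : ℝ, 0 < C ∧ ∀ v : VL2 Ω,
    VMemH10 v → l4Norm v ^ 2 ≤ C * (‖v‖ * gradNorm v) := by
  obtain ⟨C, hC, h⟩ := exists_ladyzhenskaya Ω
  refine ⟨8 * C + 1, by positivity, fun v hv => ?_⟩
  have h1 : ∀ i, (eLpNorm (v i) 4 (vol Ω)).toReal ^ 2 ≤ C * (‖v‖ * (2 * gradNorm v)) := by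
    intro i
    have h2 := ENNReal.toReal_mono (by simp) (h _ (hv i))
    rw [ENNReal.toReal_ofReal (Real.sqrt_nonneg _)] at h2
    have h3 := pow_le_pow_left₀ (by positivity) h2 2
    rw [Real.sq_sqrt (by positivity)] at h3
    refine h3.trans ?_
    gcongr
    · exact PiLp.norm_apply_le v i
    · refine (Finset.sum_le_sum fun j _ => norm_pd_le_gradNorm v i j).trans_eq ?_
      simp
  have h0 := h1 0
  have h2 := h1 1
  have hn : 0 ≤ ‖v‖ * gradNorm v := mul_nonneg (norm_nonneg _) (gradNorm_nonneg v)
  rw [l4Norm, Fin.sum_univ_two]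
  nlinarith [sq_nonneg ((eLpNorm (v 0) 4 (vol Ω)).toReal - (eLpNorm (v 1) 4 (vol Ω)).toReal)]

theorem memLp_mul_of_memLp_four {p q : L2 Ω} (hp : MemLp p 4 (vol Ω)) (hq : MemLp q 4 (vol Ω)) :
    MemLp (fun x => p x * q x) 2 (vol Ω) ∧ (eLpNorm (fun x => p x * q x) 2 (vol Ω)).toReal ≤
      (eLpNorm p 4 (vol Ω)).toReal * (eLpNorm q 4 (vol Ω)).toReal := by
  have : ENNReal.HolderTriple 4 4 2 := ⟨by
    rw [← two_mul, show (4 : ENNReal) = 2 * 2 by norm_num,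
      ENNReal.mul_inv (by simp) (by simp), ← mul_assoc, ENNReal.mul_inv_cancel (by simp) (by simp),
      one_mul]⟩
  have h := eLpNorm_smul_le_mul_eLpNorm (p := 4) (q := 4) (r := 2) hq.1 hp.1
  refine ⟨hq.mul hp, ?_⟩
  rw [← ENNReal.toReal_mul]
  exact ENNReal.toReal_mono (ENNReal.mul_ne_top hp.2.ne hq.2.ne) h

theorem integrable_triple (g : L2 Ω) {p q : L2 Ω} (hp : MemLp p 4 (vol Ω))
    (hq : MemLp q 4 (vol Ω)) : Integrable (fun x => p x * g x * q x) (vol Ω) := by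
  refine ((memLp_mul_of_memLp_four hp hq).1.integrable_mul (Lp.memLp g)).congr
    (Eventually.of_forall fun x => ?_)
  simp only [Pi.mul_apply]; ring

theorem abs_integral_triple_le (g : L2 Ω) {p q : L2 Ω} (hp : MemLp p 4 (vol Ω))
    (hq : MemLp q 4 (vol Ω)) : |∫ x, p x * g x * q x ∂(vol Ω)| ≤
      (eLpNorm p 4 (vol Ω)).toReal * ‖g‖ * (eLpNorm q 4 (vol Ω)).toReal := by
  obtain ⟨h1, h2⟩ := memLp_mul_of_memLp_four hp hq
  have e : ∫ x, p x * g x * q x ∂(vol Ω) = inner ℝ (h1.toLp _) g := by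
    rw [L2.inner_def]
    refine integral_congr_ae ?_
    filter_upwards [h1.coeFn_toLp] with x hx
    rw [hx]
    simp only [RCLike.inner_apply, RCLike.conj_to_real]; ring
  rw [e]
  refine (abs_real_inner_le_norm _ _).trans ?_
  rw [Lp.norm_toLp, mul_right_comm]
  gcongr

theorem abs_conv_le {v φ : VL2 Ω} (hv : VMemH10 v) (w : VL2 Ω) (hφ : VMemH10 φ) :
    |conv v w φ| ≤ l4Norm v * gradNorm w * l4Norm φ := by
  have e : l4Norm v * gradNorm w * l4Norm φ = ∑ i, ∑ j, (eLpNorm (v j) 4 (vol Ω)).toReal *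
      gradNorm w * (eLpNorm (φ i) 4 (vol Ω)).toReal := by
    simp only [l4Norm, Fin.sum_univ_two]; ring
  rw [e]
  refine (Finset.abs_sum_le_sum_abs _ _).trans (Finset.sum_le_sum fun i _ => ?_)
  refine (Finset.abs_sum_le_sum_abs _ _).trans (Finset.sum_le_sum fun j _ => ?_)
  refine (abs_integral_triple_le _ (hv j).memLp_four (hφ i).memLp_four).trans ?_
  gcongr
  exact norm_pd_le_gradNorm w i j

theorem abs_b_le {v w φ : VL2 Ω} (hv : VMemH10 v) (hw : VMemH10 w) (hφ : VMemH10 φ) :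
    |b v w φ| ≤ l4Norm v * (gradNorm w * l4Norm φ + gradNorm φ * l4Norm w) := by
  have h1 := abs_conv_le hv w hφ
  have h2 := abs_conv_le hv φ hw
  have h3 : 0 ≤ l4Norm v * gradNorm w * l4Norm φ := (abs_nonneg _).trans h1
  have h4 : 0 ≤ l4Norm v * gradNorm φ * l4Norm w := (abs_nonneg _).trans h2
  rw [abs_le] at h1 h2 ⊢
  unfold b
  constructor <;> linarith

theorem b_self (v w : VL2 Ω) : b v w w = 0 := by unfold b; ring

theorem b_antisymm (v w φ : VL2 Ω) : b v w φ = -b v φ w := by unfold b; ring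

theorem conv_add_left {v v' φ : VL2 Ω} (hv : VMemH10 v) (hv' : VMemH10 v') (w : VL2 Ω)
    (hφ : VMemH10 φ) : conv (v + v') w φ = conv v w φ + conv v' w φ := by
  simp only [conv, ← Finset.sum_add_distrib]
  refine Finset.sum_congr rfl fun i _ => Finset.sum_congr rfl fun j _ => ?_
  rw [← integral_add (integrable_triple _ (hv j).memLp_four (hφ i).memLp_four)
    (integrable_triple _ (hv' j).memLp_four (hφ i).memLp_four)]
  refine integral_congr_ae ?_
  filter_upwards [Lp.coeFn_add (v j) (v' j)] with x hx
  rw [PiLp.add_apply, hx, Pi.add_apply]; ring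

theorem conv_add_middle {v w w' φ : VL2 Ω} (hv : VMemH10 v) (hw : VMemH10 w) (hw' : VMemH10 w')
    (hφ : VMemH10 φ) : conv v (w + w') φ = conv v w φ + conv v w' φ := by
  simp only [conv, ← Finset.sum_add_distrib]
  refine Finset.sum_congr rfl fun i _ => Finset.sum_congr rfl fun j _ => ?_
  rw [← integral_add (integrable_triple _ (hv j).memLp_four (hφ i).memLp_four)
    (integrable_triple _ (hv j).memLp_four (hφ i).memLp_four)]
  refine integral_congr_ae ?_
  filter_upwards [Lp.coeFn_add (pd j (w i)) (pd j (w' i))] with x hx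
  rw [PiLp.add_apply, (hw i).pd_add (hw' i), hx, Pi.add_apply]; ring

theorem conv_add_right {v φ φ' : VL2 Ω} (hv : VMemH10 v) (w : VL2 Ω) (hφ : VMemH10 φ)
    (hφ' : VMemH10 φ') : conv v w (φ + φ') = conv v w φ + conv v w φ' := by
  simp only [conv, ← Finset.sum_add_distrib]
  refine Finset.sum_congr rfl fun i _ => Finset.sum_congr rfl fun j _ => ?_
  rw [← integral_add (integrable_triple _ (hv j).memLp_four (hφ i).memLp_four)
    (integrable_triple _ (hv j).memLp_four (hφ' i).memLp_four)]
  refine integral_congr_ae ?_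
  filter_upwards [Lp.coeFn_add (φ i) (φ' i)] with x hx
  rw [PiLp.add_apply, hx, Pi.add_apply]; ring

theorem b_add_left {v v' w φ : VL2 Ω} (hv : VMemH10 v) (hv' : VMemH10 v') (hw : VMemH10 w)
    (hφ : VMemH10 φ) : b (v + v') w φ = b v w φ + b v' w φ := by
  unfold b
  rw [conv_add_left hv hv' w hφ, conv_add_left hv hv' φ hw]; ring

theorem b_add_middle {v w w' φ : VL2 Ω} (hv : VMemH10 v) (hw : VMemH10 w) (hw' : VMemH10 w')
    (hφ : VMemH10 φ) : b v (w + w') φ = b v w φ + b v w' φ := by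
  unfold b
  rw [conv_add_middle hv hw hw' hφ, conv_add_right hv φ hw hw']; ring

/-- This identity, shared with the second method, is all that the estimates use about the fine
nonlinearity. -/
theorem fineTermI_self {y z : VL2 Ω} (hu : VMemH10 (y + z)) (hy : VMemH10 y) (hz : VMemH10 z) :
    fineTermI y z z = b (y + z) y z := by
  rw [fineTermI, b_add_middle hu hy hz hz, b_self, add_zero]

theorem fineTermII_self (y z : VL2 Ω) : fineTermII y z z = b (y + z) y z := by
  rw [fineTermII, b_self, add_zero]

/-- By antisymmetry the split equations conserve energy just as the unsplit one: `b u u y` reduces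
to `b u z y`, the opposite of `b u y z`. -/
theorem b_coarse_add_b_fine {y z : VL2 Ω} (hu : VMemH10 (y + z)) (hy : VMemH10 y)
    (hz : VMemH10 z) : b (y + z) (y + z) y + b (y + z) y z = 0 := by
  rw [b_add_middle hu hy hz hy, b_self, b_antisymm _ z]; ring

/-! ### The fine scale component -/

theorem FEPair.J_vMemH10 (S : FEPair Ω) {v : VL2 Ω} (hv : v ∈ S.J) : VMemH10 v :=
  S.velocity_mem v hv.1

theorem VMemH10.integral_divergence {v : VL2 Ω} (hv : VMemH10 v) :
    ∫ x, divergence v x ∂(vol Ω) = 0 := by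
  have h : ∀ i, Integrable (pd i (v i)) (vol Ω) := fun i =>
    (Lp.memLp (pd i (v i))).integrable (by norm_num)
  rw [divergence, Fin.sum_univ_two, integral_congr_ae (Lp.coeFn_add _ _)]
  simp only [Pi.add_apply]
  rw [integral_add (h 0) (h 1), (hv 0).integral_pd, (hv 1).integral_pd, add_zero]

/-- The divergence of `z` is orthogonal to the discrete pressures, by definition of `J`, and to
constants, because its mean vanishes. So `q` may be replaced by its approximation error modulo
constants. -/
theorem FEPair.Approximates.abs_inner_divergence_le {S : FEPair Ω} {h K₀ K₅ : ℝ}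
    (hS : S.Approximates h K₀ K₅) (hh : 0 ≤ h) (hK₀ : 0 ≤ K₀) {q : L2 Ω} (hq : MemH1 q)
    {z : VL2 Ω} (hz : z ∈ S.J) :
    |inner ℝ q (divergence z)| ≤ K₀ * h * normH1 q * (2 * gradNorm z) := by
  obtain ⟨qh, hqh, r, hr⟩ := hS.pressure_approx q hq
  have hc : MemLp (fun _ : Plane => r) 2 (vol Ω) := memLp_const r
  have h0 : inner ℝ (hc.toLp _) (divergence z) = 0 := by
    rw [L2.inner_def]
    have e : ∫ x, inner ℝ ((hc.toLp _ : L2 Ω) x) (divergence z x) ∂(vol Ω)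
        = ∫ x, r * divergence z x ∂(vol Ω) := by
      refine integral_congr_ae ?_
      filter_upwards [hc.coeFn_toLp] with x hx
      rw [hx]
      simp [mul_comm]
    rw [e, integral_const_mul, (S.J_vMemH10 hz).integral_divergence, mul_zero]
  have e : inner ℝ q (divergence z) = inner ℝ (q - qh - hc.toLp _) (divergence z) := by
    rw [inner_sub_left, inner_sub_left, h0, hz.2 qh hqh, sub_zero, sub_zero]
  have hn : ‖q - qh - hc.toLp _‖ ≤ K₀ * h * normH1 q := by
    rw [Lp.norm_def]
    have e2 : eLpNorm (q - qh - hc.toLp _ : L2 Ω) 2 (vol Ω)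
        = eLpNorm (fun x => q x - qh x - r) 2 (vol Ω) := by
      refine eLpNorm_congr_ae ?_
      filter_upwards [Lp.coeFn_sub (q - qh) (hc.toLp _), Lp.coeFn_sub q qh, hc.coeFn_toLp]
        with x h1 h2 h3
      rw [h1, Pi.sub_apply, h2, Pi.sub_apply, h3]
    rw [e2]
    refine ENNReal.toReal_le_of_le_ofReal ?_ hr
    have : 0 ≤ normH1 q := Real.sqrt_nonneg _
    positivity
  rw [e]
  refine (abs_real_inner_le_norm _ _).trans ?_
  exact mul_le_mul hn (norm_divergence_le z) (norm_nonneg _) ((norm_nonneg _).trans hn)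

/-- Elements of the fine space that are `L²`-orthogonal to the coarse space satisfy an improved
Poincaré inequality. -/
theorem exists_norm_le_mul_gradNorm_of_orthogonal (hΩ : StokesRegular Ω) {K₀ K₅ : ℝ}
    (hK₀ : 0 < K₀) (hK₅ : 0 < K₅) :
    ∃ C : ℝ, 0 < C ∧ ∀ (S SH : FEPair Ω) (h H : ℝ), 0 < h → h < H →
      S.Approximates h K₀ K₅ → SH.Approximates H K₀ K₅ →
      ∀ z ∈ S.J, (∀ φ ∈ SH.J, inner ℝ z φ = 0) → ‖z‖ ≤ C * H * gradNorm z := by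
  obtain ⟨C, hC⟩ := hΩ
  refine ⟨√(K₅ * (|C| + 1)) + 2 * K₀ * (|C| + 1), by positivity,
    fun S SH h H hh hH hS hSH z hz horth => ?_⟩
  -- Duality: the Stokes problem is solved with `z` itself as right-hand side.
  obtain ⟨v, q, hv, hw, hv2, hq, hb⟩ := hC z
  set D := |C| + 1 with hD
  have hD0 : 0 < D := by positivity
  have hH0 : 0 < H := hh.trans hH
  have hb' : C * ‖z‖ ≤ D * ‖z‖ := by
    gcongr; linarith [le_abs_self C]
  have hn2 : 0 ≤ normH2 v := Real.sqrt_nonneg _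
  have hn1 : 0 ≤ normH1 q := Real.sqrt_nonneg _
  have h2 : normH2 v ≤ D * ‖z‖ := by linarith
  have h1 : normH1 q ≤ D * ‖z‖ := by linarith
  have hgv := gradNorm_nonneg v
  have hgz := gradNorm_nonneg z
  have hzn := norm_nonneg z
  -- the gradient of `v` is of order `H`
  have hv' : gradNorm v ≤ √(K₅ * D) * H * ‖z‖ := by
    obtain ⟨vH, hvH, hvb⟩ := hSH.divfree_approx v hv hv2
    have e := hw v hv.1
    rw [hv.2, inner_zero_right, sub_zero, a_self] at e
    -- Testing with `v` gives `‖∇v‖² = (z, v)`. Orthogonality to the coarse space allows subtracting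
    -- the coarse approximation of `v`, which is accurate to order `H²`.
    have e2 : inner ℝ z v = inner ℝ z (v - vH) := by
      rw [inner_sub_right, horth vH hvH, sub_zero]
    have h3 : ‖v - vH‖ ≤ K₅ * H ^ 2 * (D * ‖z‖) := by
      have := mul_nonneg hH0.le (gradNorm_nonneg (v - vH))
      have : K₅ * H ^ 2 * normH2 v ≤ K₅ * H ^ 2 * (D * ‖z‖) := by gcongr
      linarith
    refine le_of_sq_le_sq ?_ (by positivity)
    rw [e, e2, mul_pow, mul_pow, Real.sq_sqrt (by positivity)]
    refine (real_inner_le_norm _ _).trans ?_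
    calc ‖z‖ * ‖v - vH‖ ≤ ‖z‖ * (K₅ * H ^ 2 * (D * ‖z‖)) := by gcongr
      _ = _ := by ring
  -- Testing with `z` gives `‖z‖² = a v z - (q, ∇ · z)`. The pressure term survives because `z` is
  -- only discretely divergence free; it is of order `h < H`.
  have e := hw z (S.J_vMemH10 hz)
  rw [real_inner_self_eq_norm_sq] at e
  have h3 := hS.abs_inner_divergence_le hh.le hK₀.le hq hz
  have h4 := abs_a_le v z
  have h5 : gradNorm v * gradNorm z ≤ √(K₅ * D) * H * ‖z‖ * gradNorm z := by gcongr
  have h6 : K₀ * h * normH1 q * (2 * gradNorm z) ≤ K₀ * H * (D * ‖z‖) * (2 * gradNorm z) := by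
    gcongr
  have h7 : ‖z‖ * ‖z‖ ≤ ‖z‖ * ((√(K₅ * D) + 2 * K₀ * D) * H * gradNorm z) := by
    have := le_abs_self (a v z)
    have := neg_abs_le (inner ℝ q (divergence z))
    calc ‖z‖ * ‖z‖ = ‖z‖ ^ 2 := by ring
      _ ≤ √(K₅ * D) * H * ‖z‖ * gradNorm z + K₀ * H * (D * ‖z‖) * (2 * gradNorm z) := by linarith
      _ = _ := by ring
  rcases hzn.eq_or_lt with h0 | h0
  · rw [← h0]; positivity
  · exact le_of_mul_le_mul_left h7 h0

theorem FEPair.fineComplement_orthogonal {S SH : FEPair Ω} {z : VL2 Ω}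
    (hz : z ∈ S.fineComplement SH) : ∀ φ ∈ SH.J, inner ℝ z φ = 0 := by
  obtain ⟨w, -, rfl⟩ := hz
  intro φ hφ
  exact SH.J.starProjection_inner_eq_zero w φ hφ

/-! ### The memory term -/

theorem integral_kernel_mul_inner {E : Type*} [NormedAddCommGroup E] [InnerProductSpace ℝ E]
    [CompleteSpace E] {γ δ a t : ℝ} {U : ℝ → E} (hU : IntervalIntegrable U volume a t) (e : E) :
    ∫ s in a..t, kernel γ δ (t - s) * inner ℝ (U s) e
      = inner ℝ (∫ s in a..t, kernel γ δ (t - s) • U s) e := by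
  have hV : IntervalIntegrable (fun s => kernel γ δ (t - s) • U s) volume a t :=
    hU.continuousOn_smul (by unfold kernel; fun_prop)
  have h1 := ContinuousLinearMap.intervalIntegral_comp_comm (innerSL ℝ e) hV
  simp only [innerSL_apply_apply] at h1
  rw [real_inner_comm, ← h1]
  refine intervalIntegral.integral_congr fun s _ => ?_
  simp only [inner_smul_right, real_inner_comm]

/-- The decay `exp(-δ(t-s))` is split as `exp(-(δ-α)(t-s)) exp(-α(t-s))` and Young's inequality
applied. The square of the first factor integrates to at most `1 / (2(δ-α))`; the second, joined
with `‖U‖`, produces the weighted dissipation. -/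
theorem norm_integral_kernel_le {E : Type*} [NormedAddCommGroup E] [InnerProductSpace ℝ E]
    {γ δ α a t R : ℝ} (hγ : 0 ≤ γ) (hα : α < δ) (hat : a ≤ t) {U : ℝ → E}
    (hi : IntervalIntegrable (fun s => Real.exp (2 * α * s) * ‖U s‖ ^ 2) volume a t)
    (hR : Real.exp (-2 * α * t) * ∫ s in a..t, Real.exp (2 * α * s) * ‖U s‖ ^ 2 ≤ R) :
    ‖∫ s in a..t, kernel γ δ (t - s) • U s‖ ≤ γ / 2 * (1 / (2 * (δ - α)) + R) := by
  have hκ : 0 < δ - α := sub_pos.2 hα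
  have hexp : IntervalIntegrable (fun s => Real.exp (2 * (δ - α) * s)) volume a t :=
    Continuous.intervalIntegrable (by fun_prop) _ _
  have hint := ((hexp.const_mul (Real.exp (-2 * (δ - α) * t))).add
    (hi.const_mul (Real.exp (-2 * α * t)))).const_mul (γ / 2)
  refine (intervalIntegral.norm_integral_le_of_norm_le hat ?_ hint).trans ?_
  · refine Eventually.of_forall fun s _ => ?_
    rw [norm_smul, kernel, norm_mul, Real.norm_of_nonneg hγ, Real.norm_of_nonneg (Real.exp_pos _).le]
    have e1 : Real.exp (-2 * (δ - α) * t) * Real.exp (2 * (δ - α) * s)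
        = Real.exp (-(δ - α) * (t - s)) ^ 2 := by
      rw [← Real.exp_add, ← Real.exp_nat_mul]; congr 1; push_cast; ring
    have e2 : Real.exp (-2 * α * t) * (Real.exp (2 * α * s) * ‖U s‖ ^ 2)
        = (Real.exp (-α * (t - s)) * ‖U s‖) ^ 2 := by
      rw [← mul_assoc, ← Real.exp_add, mul_pow, ← Real.exp_nat_mul]; congr 2; push_cast; ring
    have e3 : Real.exp (-δ * (t - s)) = Real.exp (-(δ - α) * (t - s)) * Real.exp (-α * (t - s)) := by
      rw [← Real.exp_add]; congr 1; ring
    rw [e1, e2, e3]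
    have := two_mul_le_add_sq (Real.exp (-(δ - α) * (t - s))) (Real.exp (-α * (t - s)) * ‖U s‖)
    have := mul_le_mul_of_nonneg_left this (by positivity : 0 ≤ γ / 2)
    linarith
  · rw [intervalIntegral.integral_const_mul, intervalIntegral.integral_add (hexp.const_mul _)
      (hi.const_mul _), intervalIntegral.integral_const_mul, intervalIntegral.integral_const_mul,
      integral_exp_two_mul hκ.ne']
    gcongr
    rw [← mul_div_assoc]
    gcongr
    rw [mul_sub, ← Real.exp_add, ← Real.exp_add]
    have : -2 * (δ - α) * t + 2 * (δ - α) * t = 0 := by ring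
    rw [this, Real.exp_zero]
    linarith [Real.exp_pos (-2 * (δ - α) * t + 2 * (δ - α) * a)]

/-! ### The final estimate for the fine scale component -/

/-- Absorption argument for the fine scale component: `η = ‖y‖`, `Y = ‖∇y‖`, `g = ‖∇z‖`, and `p`,
`q` are the `L⁴` norms of `y` and `z`. -/
theorem mul_le_of_absorption {μ H η Y g p q K₀ A₁ A₂ R B : ℝ} (hμ : 0 < μ) (hH : 0 < H)
    (hH1 : H < 1) (hη : 0 ≤ η) (hg : 0 ≤ g) (hp : 0 ≤ p) (hq : 0 ≤ q)
    (hK₀ : 0 < K₀) (hA₁ : 0 < A₁) (hA₂ : 0 < A₂) (hR : 0 ≤ R) (hηB : η ^ 2 ≤ B)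
    (hY : Y ≤ K₀ * H⁻¹ * η) (hp2 : p ^ 2 ≤ A₁ * (η ^ 2 * H⁻¹)) (hq2 : q ^ 2 ≤ A₂ * (H * g ^ 2))
    (hsmall : (K₀ * A₂ + √(A₁ * A₂)) * η ≤ μ / 2)
    (hmain : μ * g ^ 2 ≤ R * g + (p * (Y * q + g * p) + q * (Y * q + g * p)) + μ * (Y * g)) :
    H * g ≤ 2 / μ * (R + (K₀ * √(A₁ * A₂) + A₁) * B + μ * K₀ * (1 + B)) := by
  set m := √(A₁ * A₂) with hm
  have hm0 : 0 ≤ m := Real.sqrt_nonneg _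
  have hi : 0 < H⁻¹ := inv_pos.2 hH
  have hB : 0 ≤ B := (sq_nonneg η).trans hηB
  have hη1 : η ≤ 1 + B := by nlinarith [sq_nonneg (η - 1)]
  -- The factors `H⁻¹` in `p²` and `H` in `q²` cancel, so the mixed product carries no power of `H`.
  have hpq : p * q ≤ m * (η * g) := by
    refine le_of_sq_le_sq ?_ (by positivity)
    rw [mul_pow, mul_pow, hm, Real.sq_sqrt (by positivity)]
    calc p ^ 2 * q ^ 2 ≤ (A₁ * (η ^ 2 * H⁻¹)) * (A₂ * (H * g ^ 2)) := by gcongr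
      _ = _ := by field_simp
  rcases hg.eq_or_lt with h0 | h0
  · rw [← h0, mul_zero]; positivity
  have t1 : p * (Y * q + g * p) ≤ (K₀ * m + A₁) * η ^ 2 * H⁻¹ * g := by
    calc p * (Y * q + g * p) = Y * (p * q) + g * p ^ 2 := by ring
      _ ≤ K₀ * H⁻¹ * η * (m * (η * g)) + g * (A₁ * (η ^ 2 * H⁻¹)) := by gcongr
      _ = _ := by ring
  have t2 : q * (Y * q + g * p) ≤ (K₀ * A₂ + m) * η * g * g := by
    calc q * (Y * q + g * p) = Y * q ^ 2 + g * (p * q) := by ring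
      _ ≤ K₀ * H⁻¹ * η * (A₂ * (H * g ^ 2)) + g * (m * (η * g)) := by gcongr
      _ = _ := by field_simp
  -- The only contribution quadratic in `g`: smallness of `η` lets half of the viscous term absorb
  -- it.
  have t3 : (K₀ * A₂ + m) * η * g * g ≤ μ / 2 * g * g := by gcongr
  have t4 : μ * (Y * g) ≤ μ * (K₀ * H⁻¹ * η * g) := by gcongr
  have h1 : g * (μ / 2 * g) ≤ g * (R + (K₀ * m + A₁) * η ^ 2 * H⁻¹ + μ * (K₀ * H⁻¹ * η)) := by
    linarith
  have h2 := le_of_mul_le_mul_left h1 h0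
  -- All other terms grow at most like `H⁻¹`, so multiplying by `H` makes the bound uniform in `H`.
  have h3 : μ / 2 * (H * g) ≤ R + (K₀ * m + A₁) * B + μ * K₀ * (1 + B) := by
    calc μ / 2 * (H * g) = H * (μ / 2 * g) := by ring
      _ ≤ H * (R + (K₀ * m + A₁) * η ^ 2 * H⁻¹ + μ * (K₀ * H⁻¹ * η)) := by gcongr
      _ = H * R + (K₀ * m + A₁) * η ^ 2 + μ * K₀ * η := by field_simp
      _ ≤ 1 * R + (K₀ * m + A₁) * B + μ * K₀ * (1 + B) := by gcongr
      _ = _ := by ring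
  rw [div_mul_eq_mul_div, le_div_iff₀ hμ]
  linarith

/-! ### A priori estimates for the two schemes -/

theorem mem_timeSet_of_le {t₀ s t : ℝ} {T : EReal} (ht : t ∈ timeSet t₀ T) (hs : t₀ ≤ s)
    (hst : s ≤ t) : s ∈ timeSet t₀ T :=
  ⟨hs, (EReal.coe_le_coe_iff.2 hst).trans ht.2⟩

/-- The energy estimate with `u` and `y` both equal to `u_h`. It bounds the data from which the
nonlinear Galerkin stage starts. -/
theorem IsGalerkin.norm_sq_le {S : FEPair Ω} {μ γ δ α M C t₀ : ℝ} {f : ℝ → VL2 Ω} {u₀ : VL2 Ω}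
    {uh : ℝ → VL2 Ω} (hG : IsGalerkin S μ γ δ f u₀ t₀ uh) (hμ : 0 < μ) (hγ : 0 ≤ γ)
    (hα₀ : 0 < α) (hα : α ≤ δ) (hM : 0 ≤ M) (hαC : 2 * α * C ^ 2 ≤ μ) (ht₀ : 0 ≤ t₀)
    (hP : ∀ v : VL2 Ω, VMemH10 v → ‖v‖ ≤ C * gradNorm v)
    (hf : ∀ t ∈ Ioo 0 t₀, ‖f t‖ ≤ M) :
    ‖uh t₀‖ ^ 2 ≤ ‖u₀‖ ^ 2 + M ^ 2 * C ^ 2 / μ / (2 * α) := by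
  obtain ⟨D, hD⟩ := S.exists_gradient
  have hDn : ∀ t ∈ Icc 0 t₀, ‖D (uh t)‖ = gradNorm (uh t) := fun t ht =>
    norm_eq_gradNorm (hD _ (hG.mem t ht).1)
  have hmem : MemLp uh 2 (volume.restrict (Ioc 0 t₀)) := by
    obtain ⟨R, hR⟩ := isCompact_Icc.exists_bound_of_continuousOn hG.continuousOn
    refine MemLp.of_bound ((hG.continuousOn.mono Ioc_subset_Icc_self).aestronglyMeasurable
      measurableSet_Ioc) R ?_
    filter_upwards [ae_restrict_mem measurableSet_Ioc] with s hs
    exact hR s (Ioc_subset_Icc_self hs)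
  have key := norm_sq_le_of_energy D hμ hγ hα₀ hα hM hαC ht₀ hmem hG.continuousOn
    (fun _ _ => le_rfl) (fun t ht => ?_) (fun t ht => ?_)
  · refine key.trans ?_
    gcongr
    rw [hG.init]
    exact S.J.norm_starProjection_apply_le u₀
  · rw [hDn t (Ioo_subset_Icc_self ht)]
    exact hP _ (S.J_vMemH10 (hG.mem t (Ioo_subset_Icc_self ht)))
  · have htI := Ioo_subset_Icc_self ht
    obtain ⟨ut, hut, he⟩ := hG.equation t (Ioo_subset_Ioc_self ht)
    refine ⟨ut, hut.hasDerivAt (Icc_mem_nhds ht.1 ht.2), ?_⟩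
    have h1 := he (uh t) (hG.mem t htI)
    rw [b_self, neg_zero, zero_add, a_self] at h1
    have h2 : ∫ s in (0 : ℝ)..t, kernel γ δ (t - s) * inner ℝ (D (uh s)) (D (uh t))
        = ∫ s in (0 : ℝ)..t, kernel γ δ (t - s) * a (uh s) (uh t) := by
      refine intervalIntegral.integral_congr fun s hs => ?_
      rw [uIcc_of_le ht.1.le] at hs
      simp only [inner_eq_a (hD _ (hG.mem s ⟨hs.1, hs.2.trans ht.2.le⟩).1)
        (hD _ (hG.mem t htI).1)]
    rw [h2, hDn t htI, h1]
    refine (real_inner_le_norm _ _).trans ?_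
    gcongr
    exact hf t ht

section NLG

variable {N : VL2 Ω → VL2 Ω → VL2 Ω → ℝ} {S SH : FEPair Ω} {μ γ δ t₀ M : ℝ} {f : ℝ → VL2 Ω}
  {T : EReal} {uh y z : ℝ → VL2 Ω}

theorem IsNLG.mem_J_coarse (h : IsNLG N S SH μ γ δ f t₀ T uh y z)
    (hJ : S.J = SH.J ⊔ S.fineComplement SH) {t : ℝ} (ht : t ∈ timeSet t₀ T) : y t ∈ S.J := by
  rw [hJ]; exact Submodule.mem_sup_left (h.mem_coarse t ht)

theorem IsNLG.mem_J_fine (h : IsNLG N S SH μ γ δ f t₀ T uh y z)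
    (hJ : S.J = SH.J ⊔ S.fineComplement SH) {t : ℝ} (ht : t ∈ timeSet t₀ T) (ht₀ : t₀ < t) :
    z t ∈ S.J := by
  rw [hJ]; exact Submodule.mem_sup_right (h.mem_fine t ht ht₀)

theorem IsNLG.mem_J (h : IsNLG N S SH μ γ δ f t₀ T uh y z)
    (hJ : S.J = SH.J ⊔ S.fineComplement SH) {t : ℝ} (ht : t ∈ timeSet t₀ T) (ht₀ : t₀ < t) :
    y t + z t ∈ S.J :=
  S.J.add_mem (h.mem_J_coarse hJ ht) (h.mem_J_fine hJ ht ht₀)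

theorem IsNLG.inner_eq_zero (h : IsNLG N S SH μ γ δ f t₀ T uh y z) {t : ℝ}
    (ht : t ∈ timeSet t₀ T) (ht₀ : t₀ < t) : inner ℝ (z t) (y t) = 0 :=
  FEPair.fineComplement_orthogonal (h.mem_fine t ht ht₀) _ (h.mem_coarse t ht)

theorem IsNLG.norm_coarse_le (h : IsNLG N S SH μ γ δ f t₀ T uh y z) {t : ℝ}
    (ht : t ∈ timeSet t₀ T) (ht₀ : t₀ < t) : ‖y t‖ ≤ ‖y t + z t‖ := by
  refine (sq_le_sq₀ (norm_nonneg _) (norm_nonneg _)).1 ?_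
  rw [norm_add_sq_real, real_inner_comm, h.inner_eq_zero ht ht₀]
  nlinarith [sq_nonneg ‖z t‖]

variable {D : VL2 Ω →L[ℝ] PiLp 2 (fun _ : Fin 2 × Fin 2 => L2 Ω)}

theorem IsNLG.intervalIntegrable_gradient (h : IsNLG N S SH μ γ δ f t₀ T uh y z) {t : ℝ}
    (ht : t ∈ timeSet t₀ T) :
    IntervalIntegrable (fun s => D (y s + z s)) volume t₀ t := by
  rw [intervalIntegrable_iff_integrableOn_Ioc_of_le ht.1]
  exact (D.comp_memLp' (h.square_integrable t ht)).integrable (by norm_num)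

theorem IsNLG.memory_eq (h : IsNLG N S SH μ γ δ f t₀ T uh y z)
    (hJ : S.J = SH.J ⊔ S.fineComplement SH)
    (hD : ∀ v ∈ S.velocity, ∀ p, D v p = pd p.2 (v p.1)) {t : ℝ} (ht : t ∈ timeSet t₀ T)
    {φ : VL2 Ω} (hφ : φ ∈ S.J) :
    ∫ s in t₀..t, kernel γ δ (t - s) * a (y s + z s) φ
      = inner ℝ (∫ s in t₀..t, kernel γ δ (t - s) • D (y s + z s)) (D φ) := by
  rw [← integral_kernel_mul_inner (h.intervalIntegrable_gradient ht)]
  -- The endpoint `t₀`, where `z` is not required to lie in the fine complement, must be left out of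
  -- the comparison.
  refine intervalIntegral.integral_congr_ae (Eventually.of_forall fun s hs => ?_)
  rw [uIoc_of_le ht.1] at hs
  have hs' := h.mem_J hJ (mem_timeSet_of_le ht hs.1.le hs.2) hs.1
  rw [inner_eq_a (hD _ hs'.1) (hD _ hφ.1)]

/-- Sum of the coarse equation tested with `y` and the fine one tested with `z`. The time derivative
acts on `y` alone, whereas dissipation and memory involve the full `y + z`. -/
theorem IsNLG.energy_inequality (h : IsNLG N S SH μ γ δ f t₀ T uh y z)
    (hJ : S.J = SH.J ⊔ S.fineComplement SH)
    (hD : ∀ v ∈ S.velocity, ∀ p, D v p = pd p.2 (v p.1))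
    (hN : ∀ v w : VL2 Ω, VMemH10 (v + w) → VMemH10 v → VMemH10 w → N v w w = b (v + w) v w)
    {t : ℝ} (ht : t ∈ timeSet t₀ T) (ht₀ : t₀ < t) (hf : ‖f t‖ ≤ M) :
    ∃ y', HasDerivWithinAt y y' (timeSet t₀ T) t ∧
      inner ℝ y' (y t) + μ * ‖D (y t + z t)‖ ^ 2 + ∫ s in t₀..t,
        kernel γ δ (t - s) * inner ℝ (D (y s + z s)) (D (y t + z t)) ≤ M * ‖y t + z t‖ := by
  obtain ⟨y', hy', he⟩ := h.coarse_equation t ht ht₀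
  refine ⟨y', hy', ?_⟩
  have hy := h.mem_J_coarse hJ ht
  have hz := h.mem_J_fine hJ ht ht₀
  have hu := h.mem_J hJ ht ht₀
  have hy1 := S.J_vMemH10 hy
  have hz1 := S.J_vMemH10 hz
  have hu1 := S.J_vMemH10 hu
  have e1 := he (y t) (h.mem_coarse t ht)
  have e2 := h.fine_equation t ht ht₀ (z t) (h.mem_fine t ht ht₀)
  rw [h.memory_eq hJ hD ht hy] at e1
  rw [h.memory_eq hJ hD ht hz, hN _ _ hu1 hy1 hz1] at e2
  have e3 := b_coarse_add_b_fine hu1 hy1 hz1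
  have e4 := hy1.a_add_right hz1 (y t + z t)
  rw [integral_kernel_mul_inner (h.intervalIntegrable_gradient ht),
    norm_eq_gradNorm (hD _ hu.1), ← a_self, e4, map_add, inner_add_right]
  have e5 := (real_inner_le_norm (f t) (y t + z t)).trans
    (mul_le_mul_of_nonneg_right hf (norm_nonneg _))
  rw [inner_add_right] at e5
  simp only [map_add] at e1 e2 ⊢
  linarith

/-- The `L²` bound for `y` and the exponentially weighted bound for the gradient of `y + z`. -/
theorem IsNLG.coarse_bound (h : IsNLG N S SH μ γ δ f t₀ T uh y z)
    (hJ : S.J = SH.J ⊔ S.fineComplement SH)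
    (hN : ∀ v w : VL2 Ω, VMemH10 (v + w) → VMemH10 v → VMemH10 w → N v w w = b (v + w) v w)
    {α₀ α C : ℝ} (hμ : 0 < μ) (hγ : 0 ≤ γ) (hα₀ : 0 < α₀) (hα₀δ : α₀ ≤ δ)
    (hα₀C : 2 * α₀ * C ^ 2 ≤ μ) (hα : 0 < α) (hαδ : α ≤ δ) (hM : 0 ≤ M)
    (hP : ∀ v : VL2 Ω, VMemH10 v → ‖v‖ ≤ C * gradNorm v)
    (hf : ∀ t ∈ timeSet t₀ T, t₀ < t → ‖f t‖ ≤ M) {t : ℝ} (ht : t ∈ timeSet t₀ T) :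
    ‖y t‖ ^ 2 ≤ ‖uh t₀‖ ^ 2 + M ^ 2 * C ^ 2 / μ / (2 * α₀) ∧
    IntervalIntegrable (fun s => Real.exp (2 * α * s) * gradNorm (y s + z s) ^ 2) volume t₀ t ∧
    Real.exp (-2 * α * t) * ∫ s in t₀..t, Real.exp (2 * α * s) * gradNorm (y s + z s) ^ 2 ≤
      (‖uh t₀‖ ^ 2 + M ^ 2 * C ^ 2 / μ / (2 * α₀) + M ^ 2 * C ^ 2 / μ / (2 * α)) / μ := by
  obtain ⟨D, hD⟩ := S.exists_gradient
  have hsub : ∀ r ∈ timeSet t₀ T, Icc t₀ r ⊆ timeSet t₀ T := fun r hr s hs =>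
    mem_timeSet_of_le hr hs.1 hs.2
  have hDn : ∀ s ∈ timeSet t₀ T, t₀ < s → ‖D (y s + z s)‖ = gradNorm (y s + z s) := fun s hs hs' =>
    norm_eq_gradNorm (hD _ (h.mem_J hJ hs hs').1)
  have hPD : ∀ r ∈ timeSet t₀ T, ∀ s ∈ Ioo t₀ r, ‖y s + z s‖ ≤ C * ‖D (y s + z s)‖ := by
    intro r hr s hs
    have hs' := hsub r hr (Ioo_subset_Icc_self hs)
    rw [hDn s hs' hs.1]
    exact hP _ (S.J_vMemH10 (h.mem_J hJ hs' hs.1))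
  have hd : ∀ r ∈ timeSet t₀ T, ∀ s ∈ Ioo t₀ r, ∃ y', HasDerivAt y y' s ∧
      inner ℝ y' (y s) + μ * ‖D (y s + z s)‖ ^ 2 + ∫ τ in t₀..s,
        kernel γ δ (s - τ) * inner ℝ (D (y τ + z τ)) (D (y s + z s)) ≤ M * ‖y s + z s‖ := by
    intro r hr s hs
    have hs' := hsub r hr (Ioo_subset_Icc_self hs)
    obtain ⟨y', h1, h2⟩ := h.energy_inequality hJ hD hN hs' hs.1 (hf s hs' hs.1)
    exact ⟨y', h1.hasDerivAt (mem_of_superset (Icc_mem_nhds hs.1 hs.2) (hsub r hr)), h2⟩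
  have hb : ∀ r ∈ timeSet t₀ T, ‖y r‖ ^ 2 ≤ ‖uh t₀‖ ^ 2 + M ^ 2 * C ^ 2 / μ / (2 * α₀) := by
    intro r hr
    -- First use of the energy inequality, with the auxiliary small weight `α₀`.
    refine (norm_sq_le_of_energy D hμ hγ hα₀ hα₀δ hM hα₀C hr.1 (h.square_integrable r hr)
      (h.continuousOn.mono (hsub r hr)) (fun s hs => h.norm_coarse_le
        (hsub r hr (Ioo_subset_Icc_self hs)) hs.1) (hPD r hr) (hd r hr)).trans ?_
    gcongr
    rw [h.init]
    exact SH.J.norm_starProjection_apply_le _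
  have hcongr : ∀ s ∈ uIoc t₀ t, Real.exp (2 * α * s) * ‖D (y s + z s)‖ ^ 2
      = Real.exp (2 * α * s) * gradNorm (y s + z s) ^ 2 := by
    intro s hs
    rw [uIoc_of_le ht.1] at hs
    rw [hDn s (mem_timeSet_of_le ht hs.1.le hs.2) hs.1]
  have hint : IntervalIntegrable (fun s => Real.exp (2 * α * s) * ‖D (y s + z s)‖ ^ 2)
      volume t₀ t := by
    refine IntervalIntegrable.continuousOn_mul ?_ (by fun_prop)
    rw [intervalIntegrable_iff_integrableOn_Ioc_of_le ht.1]
    exact (D.comp_memLp' (h.square_integrable t ht)).integrable_norm_pow (by norm_num)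
  refine ⟨hb t ht, hint.congr hcongr, ?_⟩
  rw [← intervalIntegral.integral_congr_ae (Eventually.of_forall hcongr)]
  -- Second use, with the prescribed weight `α` and the bound on `y` just obtained.
  exact exp_mul_integral_le_of_energy D hμ hγ hα hαδ hM ht.1 (h.square_integrable t ht)
    (h.continuousOn.mono (hsub t ht)) (fun s hs => hb s (hsub t ht hs)) (hPD t ht) (hd t ht)

/-- The bound for the fine scale component when `‖y‖` is small. -/
theorem IsNLG.fine_bound (h : IsNLG N S SH μ γ δ f t₀ T uh y z)
    (hJ : S.J = SH.J ⊔ S.fineComplement SH)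
    (hN : ∀ v w : VL2 Ω, VMemH10 (v + w) → VMemH10 v → VMemH10 w → N v w w = b (v + w) v w)
    {α C C₁ C₂ K₀ H R B : ℝ} (hμ : 0 < μ) (hγ : 0 ≤ γ) (hαδ : α < δ) (hM : 0 ≤ M)
    (hC : 0 < C) (hC₁ : 0 < C₁) (hC₂ : 0 < C₂) (hK₀ : 0 < K₀) (hH : 0 < H) (hH1 : H < 1)
    (hP : ∀ v : VL2 Ω, VMemH10 v → ‖v‖ ≤ C * gradNorm v)
    (hL : ∀ v : VL2 Ω, VMemH10 v → l4Norm v ^ 2 ≤ C₁ * (‖v‖ * gradNorm v))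
    (hinv : ∀ w ∈ SH.velocity, gradNorm w ≤ K₀ * H⁻¹ * ‖w‖)
    (hfine : ∀ w ∈ S.J, (∀ φ ∈ SH.J, inner ℝ w φ = 0) → ‖w‖ ≤ C₂ * H * gradNorm w)
    {t : ℝ} (ht : t ∈ timeSet t₀ T) (ht₀ : t₀ < t) (hf : ‖f t‖ ≤ M)
    (hi : IntervalIntegrable (fun s => Real.exp (2 * α * s) * gradNorm (y s + z s) ^ 2)
      volume t₀ t)
    (hR : Real.exp (-2 * α * t) * ∫ s in t₀..t, Real.exp (2 * α * s) * gradNorm (y s + z s) ^ 2 ≤ R)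
    (hB : ‖y t‖ ^ 2 ≤ B)
    (hsmall : (K₀ * (C₁ * C₂) + √(C₁ * K₀ * (C₁ * C₂))) * ‖y t‖ ≤ μ / 2) :
    ‖z t‖ ≤ C₂ * (2 / μ * (M * C + γ / 2 * (1 / (2 * (δ - α)) + R)
      + (K₀ * √(C₁ * K₀ * (C₁ * C₂)) + C₁ * K₀) * B + μ * K₀ * (1 + B))) := by
  obtain ⟨D, hD⟩ := S.exists_gradient
  have hy := h.mem_J_coarse hJ ht
  have hz := h.mem_J_fine hJ ht ht₀
  have hy1 := S.J_vMemH10 hy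
  have hz1 := S.J_vMemH10 hz
  have hu1 := S.J_vMemH10 (h.mem_J hJ ht ht₀)
  have hzH := hfine _ hz (FEPair.fineComplement_orthogonal (h.mem_fine t ht ht₀))
  have hg := gradNorm_nonneg (z t)
  have hp := l4Norm_nonneg (y t)
  have hq := l4Norm_nonneg (z t)
  have hyg : gradNorm (y t) ≤ K₀ * H⁻¹ * ‖y t‖ := hinv _ (h.mem_coarse t ht).1
  have hR0 : 0 ≤ R := le_trans (mul_nonneg (Real.exp_pos _).le
    (intervalIntegral.integral_nonneg ht.1 fun s _ => by positivity)) hR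
  have hκ : 0 < δ - α := sub_pos.2 hαδ
  -- the memory term
  have hmem : ‖∫ s in t₀..t, kernel γ δ (t - s) • D (y s + z s)‖ ≤
      γ / 2 * (1 / (2 * (δ - α)) + R) := by
    have hcongr : ∀ s ∈ uIoc t₀ t, Real.exp (2 * α * s) * gradNorm (y s + z s) ^ 2
        = Real.exp (2 * α * s) * ‖D (y s + z s)‖ ^ 2 := by
      intro s hs
      rw [uIoc_of_le ht.1] at hs
      rw [norm_eq_gradNorm (hD _ (h.mem_J hJ (mem_timeSet_of_le ht hs.1.le hs.2) hs.1).1)]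
    refine norm_integral_kernel_le hγ hαδ ht.1 (hi.congr hcongr) ?_
    rwa [← intervalIntegral.integral_congr_ae (Eventually.of_forall hcongr)]
  have e := h.fine_equation t ht ht₀ (z t) (h.mem_fine t ht ht₀)
  -- The nonlinear term is split as `b y y z + b z y z`, and the viscous one as `a y z + ‖∇z‖²`.
  rw [h.memory_eq hJ hD ht hz, hN _ _ hu1 hy1 hz1, hy1.a_add_left hz1, a_self,
    b_add_left hy1 hz1 hy1 hz1] at e
  have b1 := neg_le_of_abs_le (abs_b_le hy1 hy1 hz1)
  have b2 := neg_le_of_abs_le (abs_b_le hz1 hy1 hz1)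
  have b3 := neg_le_of_abs_le (abs_a_le (y t) (z t))
  have b4 := neg_le_of_abs_le (abs_real_inner_le_norm
    (∫ s in t₀..t, kernel γ δ (t - s) • D (y s + z s)) (D (z t)))
  rw [norm_eq_gradNorm (hD _ hz.1)] at b4
  have b5 := mul_le_mul_of_nonneg_right hmem hg
  have b6 : inner ℝ (f t) (z t) ≤ M * (C * gradNorm (z t)) := by
    refine (real_inner_le_norm _ _).trans ?_
    have := hP _ hz1
    gcongr
  have b7 := mul_le_mul_of_nonneg_left b3 hμ.le
  -- Ladyzhenskaya combined with the inverse inequality on the coarse space.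
  have hp2 : l4Norm (y t) ^ 2 ≤ C₁ * K₀ * (‖y t‖ ^ 2 * H⁻¹) := by
    refine (hL _ hy1).trans ?_
    calc C₁ * (‖y t‖ * gradNorm (y t)) ≤ C₁ * (‖y t‖ * (K₀ * H⁻¹ * ‖y t‖)) := by gcongr
      _ = _ := by ring
  -- Ladyzhenskaya combined with the improved Poincaré inequality, which supplies the factor `H`.
  have hq2 : l4Norm (z t) ^ 2 ≤ C₁ * C₂ * (H * gradNorm (z t) ^ 2) := by
    refine (hL _ hz1).trans ?_
    calc C₁ * (‖z t‖ * gradNorm (z t)) ≤ C₁ * (C₂ * H * gradNorm (z t) * gradNorm (z t)) := by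
          gcongr
      _ = _ := by ring
  have key := mul_le_of_absorption (R := M * C + γ / 2 * (1 / (2 * (δ - α)) + R)) hμ hH hH1
    (norm_nonneg (y t)) hg hp hq hK₀ (by positivity) (by positivity) (by positivity) hB hyg hp2
    hq2 hsmall (by linarith)
  refine hzH.trans ?_
  rw [mul_assoc]
  gcongr

end NLG

end Oldroyd

end

/-! ### Choice of the constants and conclusion -/

theorem lemma4p1 (Ω : PlanarDomain) (hΩ : StokesRegular Ω)
    (μ γ δ ev₁ α M₀ K₀ K₅ : ℝ) (hμ : 0 < μ) (hγ : 0 < γ) (hδ : 0 < δ)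
    (hev : IsLeast {ev : ℝ | IsStokesEigenvalue Ω ev} ev₁)
    (hα : 0 < α) (hα' : α < min (μ * ev₁) δ)
    (hM₀ : 0 < M₀) (hK₀ : 0 < K₀) (hK₅ : 0 < K₅) :
    ∃ K : ℝ, 0 < K ∧
      ∀ H₀ κ₁ κ₂ : ℝ, 0 < H₀ → H₀ < 1 → 0 < κ₁ → 0 < κ₂ →
      ∃ c : ℝ, 0 < c ∧
        ∀ (t₀ : ℝ) (T : EReal) (f : ℝ → VL2 Ω) (u₀ : VL2 Ω) (h H : ℝ) (S SH : FEPair Ω)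
          (uh y z : ℝ → VL2 Ω),
          0 < t₀ → (t₀ : EReal) < T →
          MemJ1 u₀ → gradNorm u₀ ≤ M₀ → BoundedForce f M₀ T →
          0 < h → h < H → H < 1 →
          S.Approximates h K₀ K₅ → SH.Approximates H K₀ K₅ →
          S.J = SH.J ⊔ S.fineComplement SH →
          IsGalerkin S μ γ δ f u₀ t₀ uh →
          (IsNLG fineTermI S SH μ γ δ f t₀ T uh y z ∨
            IsNLG fineTermII S SH μ γ δ f t₀ T uh y z) →
          ∀ t ∈ timeSet t₀ T, t₀ < t →
            (IntervalIntegrable (fun s => Real.exp (2 * α * s) * gradNorm (y s + z s) ^ 2)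
                MeasureTheory.volume t₀ t ∧
              ‖y t‖ ^ 2 + Real.exp (-2 * α * t) *
                ∫ s in t₀..t, Real.exp (2 * α * s) * gradNorm (y s + z s) ^ 2 ≤ K) ∧
            ∀ LH : ℝ, H ≤ H₀ → κ₁ * √|Real.log H| ≤ LH → LH ≤ κ₂ * √|Real.log h| →
              0 < μ - c * LH ^ 2 * ‖y t‖ ^ 2 → ‖z t‖ ≤ K := by
  obtain ⟨C, hC, hP⟩ := exists_vector_poincare Ω
  obtain ⟨C₁, hC₁, hL⟩ := exists_vector_ladyzhenskaya Ω
  obtain ⟨C₂, hC₂, hF⟩ := exists_norm_le_mul_gradNorm_of_orthogonal hΩ hK₀ hK₅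
  have hαδ : α < δ := hα'.trans_le (min_le_right _ _)
  have hκ : 0 < δ - α := sub_pos.2 hαδ
  -- The auxiliary weight: at most `δ` for positivity of the memory term, and small enough for the
  -- Poincaré absorption.
  set α₀ := min δ (μ / (2 * C ^ 2)) with hα₀def
  have hα₀ : 0 < α₀ := lt_min hδ (by positivity)
  have hα₀δ : α₀ ≤ δ := min_le_left _ _
  have hα₀C : 2 * α₀ * C ^ 2 ≤ μ := by
    have := min_le_right δ (μ / (2 * C ^ 2))
    rw [← hα₀def, le_div_iff₀ (by positivity)] at this
    linarith
  set d := M₀ ^ 2 * C ^ 2 / μ / (2 * α₀) with hd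
  have hd0 : 0 < d := by positivity
  -- `(C * M₀) ^ 2` bounds `‖u₀‖²`; one `d` comes from the Galerkin stage on `[0, t₀]` and one from
  -- the nonlinear Galerkin stage.
  set B := (C * M₀) ^ 2 + d + d with hBdef
  have hB0 : 0 < B := by positivity
  set R := (B + M₀ ^ 2 * C ^ 2 / μ / (2 * α)) / μ with hRdef
  have hR0 : 0 < R := by positivity
  set m := √(C₁ * K₀ * (C₁ * C₂)) with hm
  set Kz := C₂ * (2 / μ * (M₀ * C + γ / 2 * (1 / (2 * (δ - α)) + R)
    + (K₀ * m + C₁ * K₀) * B + μ * K₀ * (1 + B))) with hKz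
  have hKz0 : 0 < Kz := by positivity
  refine ⟨B + R + Kz, by positivity, fun H₀ κ₁ κ₂ hH₀ hH₀1 hκ₁ hκ₂ => ?_⟩
  -- A positive lower bound for `L_H²`, valid for every `H ≤ H₀`. Only `c` depends on it, not `K`.
  set ℓ := κ₁ ^ 2 * |Real.log H₀| with hℓ
  have hℓ0 : 0 < ℓ := by
    have : 0 < |Real.log H₀| := abs_pos.2 (Real.log_neg hH₀ hH₀1).ne
    positivity
  set e₁ := K₀ * (C₁ * C₂) + m with he₁
  have he₁0 : 0 < e₁ := by positivity
  -- With this `c`, `c * ℓ * ‖y‖²` equals `4 (e₁ ‖y‖)² / μ`, so the hypothesis at `t` yields `e₁ ‖y‖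
  -- ≤ μ / 2`.
  refine ⟨4 * e₁ ^ 2 / (μ * ℓ), by positivity, ?_⟩
  intro t₀ T f u₀ h H S SH uh y z ht₀ htT hu₀ hu₀M hf hh hhH hH1 hS hSH hJ hG hNLG t ht htt
  have hH : 0 < H := hh.trans hhH
  have huh : ‖uh t₀‖ ^ 2 ≤ (C * M₀) ^ 2 + d := by
    refine (hG.norm_sq_le hμ hγ.le hα₀ hα₀δ hM₀.le hα₀C ht₀.le hP fun s hs => hf.1 s
      ⟨hs.1.le, (EReal.coe_le_coe_iff.2 hs.2.le).trans htT.le⟩ hs.1).trans ?_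
    gcongr
    exact (hP _ hu₀.1).trans (by gcongr)
  have hfN : ∀ s ∈ timeSet t₀ T, t₀ < s → ‖f s‖ ≤ M₀ := fun s hs hs' =>
    hf.1 s ⟨ht₀.le.trans hs.1, hs.2⟩ (ht₀.trans hs')
  obtain ⟨N, hN, hNLG⟩ : ∃ N : VL2 Ω → VL2 Ω → VL2 Ω → ℝ,
      (∀ v w : VL2 Ω, VMemH10 (v + w) → VMemH10 v → VMemH10 w → N v w w = b (v + w) v w) ∧
      IsNLG N S SH μ γ δ f t₀ T uh y z := by
    rcases hNLG with h1 | h1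
    · exact ⟨_, fun v w hu hv hw => fineTermI_self hu hv hw, h1⟩
    · exact ⟨_, fun v w _ _ _ => fineTermII_self v w, h1⟩
  obtain ⟨b1, b2, b3⟩ := hNLG.coarse_bound hJ hN hμ hγ.le hα₀ hα₀δ hα₀C hα hαδ.le hM₀.le hP hfN ht
  have b1' : ‖y t‖ ^ 2 ≤ B := b1.trans (by rw [← hd]; linarith)
  have b3' : Real.exp (-2 * α * t) *
      ∫ s in t₀..t, Real.exp (2 * α * s) * gradNorm (y s + z s) ^ 2 ≤ R := by
    refine b3.trans ?_
    rw [hRdef]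
    gcongr
    linarith
  refine ⟨⟨b2, by linarith⟩, fun LH hHH₀ hLH _ hc => ?_⟩
  have hlog : |Real.log H₀| ≤ |Real.log H| := by
    rw [abs_of_neg (Real.log_neg hH₀ hH₀1), abs_of_neg (Real.log_neg hH hH1), neg_le_neg_iff]
    exact Real.log_le_log hH hHH₀
  have hLℓ : ℓ ≤ LH ^ 2 := by
    have h1 := pow_le_pow_left₀ (by positivity) hLH 2
    rw [mul_pow, Real.sq_sqrt (abs_nonneg _)] at h1
    refine le_trans ?_ h1
    rw [hℓ]; gcongr
  have hsmall : e₁ * ‖y t‖ ≤ μ / 2 := by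
    refine le_of_sq_le_sq ?_ (by positivity)
    have h1 : 4 * e₁ ^ 2 / (μ * ℓ) * ℓ * ‖y t‖ ^ 2 ≤ 4 * e₁ ^ 2 / (μ * ℓ) * LH ^ 2 * ‖y t‖ ^ 2 := by
      gcongr
    have h2 : 4 * e₁ ^ 2 / (μ * ℓ) * ℓ * ‖y t‖ ^ 2 = 4 * (e₁ * ‖y t‖) ^ 2 / μ := by field_simp
    have h3 : 4 * (e₁ * ‖y t‖) ^ 2 / μ ≤ μ := by linarith
    rw [div_le_iff₀ hμ] at h3
    linarith
  have := hNLG.fine_bound hJ hN hμ hγ.le hαδ hM₀.le hC hC₁ hC₂ hK₀ hH hH1 hP hL hSH.inverse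
    (hF S SH h H hh hhH hS hSH) ht htt (hfN t ht htt) b2 b3' b1' hsmall
  linarith
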